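/- **Definitions.** Let $q$ be a prime power and let $\mathcal C\subseteq\mathbb F_q^n$ be an $[n,k,d]_q$ linear code, that is, a $k$-dimensional subspace with minimum Hamming distance $d$. The $i$th code symbol has $(r,\delta)$-locality if there is $S_i\subseteq\{1,\dots,n\}$ with $i\in S_i$, $|S_i|\le r+\delta-1$, such that the punctured code $\mathcal C|_{S_i}$ has minimum distance at least $\delta$. The code $\mathcal C$ has $(r,\delta)_i$-locality (information locality) if for some set $I$ of $k$ coordinates such that the corresponding columns of a generator matrix have rank $k$, each symbol with index in $I$ has $(r,\delta)$-locality. Such a code is *optimal* if $d=n-k+1-(\lceil k/r\rceil-1)(\delta-1)$. A $t$-$(m,s,1)$-packing (with $m\ge 2$ and $t,s\ge1$) is a set $X$ of $m$ points with a set $\mathcal B$ of $s$-subsets of $X$ (blocks) such that each $t$-subset of $X$ lies in at most one block; it is a $(t,s,m)$-Steiner system if each $t$-subset lies in exactly one block. For integers $\delta\ge1$ and $0\le a\le h$ put $T(a)=\lfloor (h+\delta-a-1)/\delta\rfloor$. For constant $r,\delta,h$, a family of lengths $n$ of optimal codes with $(r,\delta)_i$-locality and $d=h+\delta$ over $\mathbb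 F_q$ is *order-optimal* if, for some $0\le a\le h$ with $T(a)\ge2$, $n=\Theta\big(q^{\frac{2(h-a-1)}{T(a)-1}-1}\big)$ when $T(a)$ is odd, and $n=\Theta\big(q^{\frac{2(h-a)}{T(a)}-1}\big)$ when $T(a)$ is even. **Setting.** Let $r,\delta,\tau\ge1$ and $0\le h\le\lceil\delta/\tau\rceil\,\delta$ be fixed integers. Let $(q_i)_{i\in\mathcal I}$ be a family of prime powers; $O$, $\Omega$, $\Theta$ refer to this family, along any given filter on $\mathcal I$ (for instance $i\to\infty$ for a sequence). **(1) Packings.** For each $i$ let $1\le v_i\le r$ and let there be given a $(\tau+1)$-$(q_i-h,\,r+\delta-1,\,1)$-packing with a non-empty set $\mathcal B_i$ of blocks, such that $|\mathcal B_i|=\Omega((q_i-h)^{\tau+1})$. Then there are optimal $[n_i,k_i,d]_{q_i}$ linear codes with $(r,\delta)_i$-locality, where $$n_i=|\mathcal B_i|(r+\delta-1)+h+v_i-r,\qquad k_i=(|\mathcal B_i|-1)r+v_i,\qquad d=h+\delta,$$ and $n_i=\Omega(q_i^{\tau+1})$. Furthermore, if $h\ge\delta+1$, $\tau=\delta-1$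 and $v_i=r$ for all $i$, then $n_i=\Theta(q_i^{\delta})$, these codes have order-optimal length, and there is a constant $K$ such that (along the filter) every optimal code over $\mathbb F_{q_i}$ with $(r,\delta)_i$-locality, minimum distance $h+\delta$ and dimension divisible by $r$ has length at most $K n_i$. **(2) Steiner systems.** For each $i$ let $q_i-h\ge\tau+1$ and let there be given a $(\tau+1,\,r+\delta-1,\,q_i-h)$-Steiner system. Then there are optimal $[n_i,k_i,d]_{q_i}$ linear codes with $(r,\delta)_i$-locality, where $$n_i=\frac{\binom{q_i-h}{\tau+1}(r+\delta-1)}{\binom{r+\delta-1}{\tau+1}}+h,\qquad k_i=\frac{r\binom{q_i-h}{\tau+1}}{\binom{r+\delta-1}{\tau+1}},\qquad d=h+\delta,$$ and $n_i=\Omega(q_i^{\tau+1})$. In particular, if $h\ge\delta+1$ and $\tau=\delta-1$, then $n_i=\Theta(q_i^\delta)$, these codes have order-optimal length, and there is a constant $K$ such that (along the filter) every optimal code over $\mathbb F_{q_i}$ with $(r,\delta)_i$-locality, minimum distance $h+\delta$ and dimension divisible by $r$ has length at most $K n_i$. -/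

import Mathlib

open Filter Asymptotics

namespace LRC

section Codes

variable {F : Type*} [Field F] {n : ℕ}

/-- The punctured code `C|_S`: delete all code symbols outside `S`. -/
def puncture (C : Submodule F (Fin n → F)) (S : Finset (Fin n)) : Submodule F (S → F) :=
  C.map (LinearMap.funLeft F F (fun i : S => (i : Fin n)))

/-- `G` is a generator matrix of `C`: its rows form a basis of `C`. -/
def IsGeneratorMatrix {k : ℕ} (G : Matrix (Fin k) (Fin n) F) (C : Submodule F (Fin n → F)) :
    Prop :=
  LinearIndependent F G.row ∧ Submodule.span F (Set.range G.row) = C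

/-- `rank(I)`: the dimension of the span of the columns of `G` indexed by `I`. -/
noncomputable def columnRank {k : ℕ} (G : Matrix (Fin k) (Fin n) F) (I : Finset (Fin n)) : ℕ :=
  Module.finrank F (Submodule.span F (G.col '' (I : Set (Fin n))))

variable [DecidableEq F]

/-- `d` is the minimum Hamming distance of the linear code `C`, that is, the least Hamming weight
of a nonzero codeword. (The zero code has no minimum distance.) -/
def HasMinDist (C : Submodule F (Fin n → F)) (d : ℕ) : Prop :=
  IsLeast {w : ℕ | ∃ c ∈ C, c ≠ 0 ∧ hammingNorm c = w} d

/-- The `i`th code symbol of `C` has `(r, δ)`-locality. -/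
def HasSymbolLocality (C : Submodule F (Fin n → F)) (r δ : ℕ) (i : Fin n) : Prop :=
  ∃ S : Finset (Fin n), i ∈ S ∧ S.card ≤ r + δ - 1 ∧
    ∀ c ∈ puncture C S, c ≠ 0 → δ ≤ hammingNorm c

/-- `C` has information `(r, δ)`-locality: for some set `I` of `k = dim C` coordinates of rank `k`,
every code symbol with index in `I` has `(r, δ)`-locality. -/
def HasInfoLocality (C : Submodule F (Fin n → F)) (r δ : ℕ) : Prop :=
  ∃ G : Matrix (Fin (Module.finrank F C)) (Fin n) F, IsGeneratorMatrix G C ∧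
    ∃ I : Finset (Fin n), I.card = Module.finrank F C ∧
      columnRank G I = Module.finrank F C ∧ ∀ i ∈ I, HasSymbolLocality C r δ i

/-- `C` is an optimal `[n, k, d]` linear code with information `(r, δ)`-locality: it meets the
Singleton-type bound `d ≤ n - k + 1 - (⌈k / r⌉ - 1) (δ - 1)` with equality. -/
structure IsOptimalLRC (r δ k d : ℕ) (C : Submodule F (Fin n → F)) : Prop where
  dim_eq : Module.finrank F C = k
  minDist : HasMinDist C d
  locality : HasInfoLocality C r δ
  bound_eq : (d : ℤ) = (n : ℤ) - k + 1 - (⌈(k : ℚ) / (r : ℚ)⌉ - 1) * ((δ : ℤ) - 1)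

end Codes

section Designs

variable {X : Type*} [Fintype X]

/-- `(X, B)` is a `τ`-`(n, t, 1)`-packing. -/
structure IsPacking (τ n t : ℕ) (B : Finset (Finset X)) : Prop where
  two_le : 2 ≤ n
  τ_pos : 0 < τ
  t_pos : 0 < t
  card_points : Fintype.card X = n
  card_block : ∀ b ∈ B, b.card = t
  at_most_one : ∀ T : Finset X, T.card = τ →
    ∀ b ∈ B, ∀ b' ∈ B, T ⊆ b → T ⊆ b' → b = b'

/-- `(X, B)` is a `(τ, t, n)`-Steiner system. -/
structure IsSteinerSystem (τ t n : ℕ) (B : Finset (Finset X)) : Prop where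
  two_le : 2 ≤ n
  τ_pos : 0 < τ
  t_pos : 0 < t
  card_points : Fintype.card X = n
  card_block : ∀ b ∈ B, b.card = t
  exactly_one : ∀ T : Finset X, T.card = τ → ∃! b, b ∈ B ∧ T ⊆ b

end Designs

section OrderOptimality

/-- `T(a) = ⌊(d - a - 1) / δ⌋` with `d = h + δ`; used only for `a ≤ h` and `1 ≤ δ`. -/
def levelT (δ h a : ℕ) : ℕ := (h + δ - a - 1) / δ

/-- The exponent of `q` in the upper bound on the length of optimal codes with information
`(r, δ)`-locality and minimum distance `h + δ`, for the parameter `a`. -/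
noncomputable def boundExponent (δ h a : ℕ) : ℝ :=
  if Odd (levelT δ h a) then
    2 * ((h : ℝ) - a - 1) / ((levelT δ h a : ℝ) - 1) - 1
  else
    2 * ((h : ℝ) - a) / (levelT δ h a : ℝ) - 1

/-- Lengths `n i` over fields of size `q i` attain the upper bound on the length of optimal codes
up to a constant factor, for some admissible value of the parameter `a` of the bound. -/
def IsOrderOptimalLength {ι : Type*} (l : Filter ι) (δ h : ℕ) (q n : ι → ℕ) : Prop :=
  ∃ a : ℕ, a ≤ h ∧ 2 ≤ levelT δ h a ∧
    (fun i => (n i : ℝ)) =Θ[l] (fun i => (q i : ℝ) ^ boundExponent δ h a)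

/-- Up to a constant factor, no optimal code over `F i` with information `(r, δ)`-locality,
minimum distance `h + δ` and dimension divisible by `r` is longer than `n i`. -/
def IsLongestUpToConstant {ι : Type*} (l : Filter ι) (r δ h : ℕ) (F : ι → Type*)
    [∀ i, Field (F i)] [∀ i, DecidableEq (F i)] (n : ι → ℕ) : Prop :=
  ∃ K : ℝ, ∀ᶠ i in l, ∀ (m k : ℕ) (C : Submodule (F i) (Fin m → F i)),
    IsOptimalLRC r δ k (h + δ) C → r ∣ k → (m : ℝ) ≤ K * (n i : ℝ)

end OrderOptimality

end LRC

/-! The field elements are split into `q - h` points `α p`, which carry the packing, and `h` poles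
`β j`. A word has one coordinate for each incident pair of block and point, and `h` global
coordinates. Each block satisfies `δ - 1` power-moment checks, so it is an MDS code of distance `δ`;
the check for `β j` expresses the `j`th global coordinate through the sum of all blocks, weighted by
`1 / (α p - β j)`.

Distance: take a codeword of weight below `h + δ` and add its blocks up pointwise. The sum satisfies
`δ - 1` moments and one Cauchy condition for each vanishing global coordinate, and its weight is at
most the number of these conditions. The Cauchy-Vandermonde argument `eq_zero_of_moments` makes it
zero. By `all_eq_zero_of_sum_eq_zero` the blocks cannot cancel unless all vanish: at most `⌈δ/τ⌉`
are nonzero, so any one of them meets the others in fewer than `δ` points, while its weight is at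
least `δ`. The global coordinates then vanish too. `exists_isOptimalLRC_of_blocks` adds the
dimension and a word of weight at most `h + δ`.

Converse length bound, for `r ∣ k`: optimality makes a greedy choice of repair sets tight, which
yields `u = k / r` disjoint sets of size `r + δ - 1` with local dimension `r`
(`exists_disjoint_repair_sets`). Each carries a word of weight at most `δ`; packing translates of
the code by multiples of these words gives `u (q - 1) ≤ q ^ (δ + 1)` (`card_repair_sets_le`), so the
length is `O(q ^ δ)`. When `τ + 1 = δ` the construction reaches this order. A Steiner system is a
packing whose number of blocks is known exactly. -/

namespace LRC

/-! ### Information sets, locality, and relabelling of coordinates. -/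

section Puncturing

variable {F : Type*} [Field F] {n : ℕ}

/-- Row rank equals column rank for the submatrix of `G` on the columns `I`, and its rows span the
punctured code. -/
theorem columnRank_eq_finrank_puncture {k : ℕ} {G : Matrix (Fin k) (Fin n) F}
    {C : Submodule F (Fin n → F)} (hG : IsGeneratorMatrix G C) (I : Finset (Fin n)) :
    columnRank G I = Module.finrank F (puncture C I) := by
  have hcol : G.col '' (I : Set (Fin n)) =
      Set.range (G.submatrix id (fun i : I => (i : Fin n))).col := by
    ext x
    constructor
    · rintro ⟨i, hi, rfl⟩
      exact ⟨⟨i, hi⟩, rfl⟩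
    · rintro ⟨i, rfl⟩
      exact ⟨i, i.2, rfl⟩
  have hrow : (LinearMap.funLeft F F (fun i : I => (i : Fin n))) '' Set.range G.row =
      Set.range (G.submatrix id (fun i : I => (i : Fin n))).row := by
    rw [← Set.range_comp]
    rfl
  rw [columnRank, hcol, ← Matrix.rank_eq_finrank_span_cols, Matrix.rank_eq_finrank_span_row,
    puncture, ← hG.2, Submodule.map_span, hrow]

theorem finrank_puncture_eq_iff (C : Submodule F (Fin n → F)) (I : Finset (Fin n)) :
    Module.finrank F (puncture C I) = Module.finrank F C ↔
      ∀ c ∈ C, (∀ i ∈ I, c i = 0) → c = 0 := by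
  set f := (LinearMap.funLeft F F (fun i : I => (i : Fin n))).domRestrict C with hf
  have hr : puncture C I = LinearMap.range f := by
    rw [hf, LinearMap.range_domRestrict]; rfl
  have h2 := f.finrank_range_add_finrank_ker
  rw [hr]
  constructor
  · intro h c hc hI
    have h3 : Module.finrank F (LinearMap.ker f) = 0 := by omega
    rw [Submodule.finrank_eq_zero] at h3
    have : (⟨c, hc⟩ : C) ∈ LinearMap.ker f := by
      rw [LinearMap.mem_ker]
      ext i
      exact hI i i.2
    rw [h3, Submodule.mem_bot] at this
    exact congrArg Subtype.val this
  · intro h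
    have h3 : LinearMap.ker f = ⊥ := by
      rw [Submodule.eq_bot_iff]
      rintro ⟨c, hc⟩ hx
      rw [LinearMap.mem_ker] at hx
      have := h c hc (fun i hi => congrFun hx ⟨i, hi⟩)
      exact Subtype.ext this
    rw [h3, finrank_bot] at h2
    omega

theorem exists_isGeneratorMatrix (C : Submodule F (Fin n → F)) :
    ∃ G : Matrix (Fin (Module.finrank F C)) (Fin n) F, IsGeneratorMatrix G C := by
  let b := Module.finBasis F C
  refine ⟨fun i => (b i : Fin n → F), ?_, ?_⟩
  · exact b.linearIndependent.map' C.subtype C.ker_subtype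
  · have h : Set.range (fun i => ((b i : C) : Fin n → F)) = C.subtype '' Set.range b := by
      rw [← Set.range_comp]; rfl
    change Submodule.span F (Set.range (fun i => ((b i : C) : Fin n → F))) = C
    rw [h, ← Submodule.map_span, b.span_eq, Submodule.map_top, Submodule.range_subtype]

variable [DecidableEq F]

theorem puncture_minDist_iff (C : Submodule F (Fin n → F)) (S : Finset (Fin n)) (δ : ℕ) :
    (∀ c ∈ puncture C S, c ≠ 0 → δ ≤ hammingNorm c) ↔
      ∀ c ∈ C, (∃ j ∈ S, c j ≠ 0) → δ ≤ (S.filter (fun j => c j ≠ 0)).card := by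
  have key : ∀ c : Fin n → F,
      hammingNorm (LinearMap.funLeft F F (fun i : S => (i : Fin n)) c) =
        (S.filter (fun j => c j ≠ 0)).card := by
    intro c
    rw [hammingNorm]
    refine Finset.card_bij (fun a _ => a.1) ?_ ?_ ?_
    · intro a ha
      exact Finset.mem_filter.2 ⟨a.2, (Finset.mem_filter.1 ha).2⟩
    · intro a _ b _ h
      exact Subtype.ext h
    · intro b hb
      rw [Finset.mem_filter] at hb
      exact ⟨⟨b, hb.1⟩, Finset.mem_filter.2 ⟨Finset.mem_univ _, hb.2⟩, rfl⟩
  constructor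
  · rintro h c hc ⟨j, hj, hcj⟩
    rw [← key]
    refine h _ ⟨c, hc, rfl⟩ (fun h0 => hcj ?_)
    exact congrFun h0 ⟨j, hj⟩
  · rintro h _ ⟨c, hc, rfl⟩ hne
    rw [key]
    obtain ⟨j, hj⟩ := Function.ne_iff.1 hne
    exact h c hc ⟨j, j.2, hj⟩

/-- Information locality in terms of an information set. -/
theorem hasInfoLocality_iff (C : Submodule F (Fin n → F)) (r δ : ℕ) :
    HasInfoLocality C r δ ↔ ∃ I : Finset (Fin n), I.card = Module.finrank F C ∧
      (∀ c ∈ C, (∀ i ∈ I, c i = 0) → c = 0) ∧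
      ∀ i ∈ I, ∃ S : Finset (Fin n), i ∈ S ∧ S.card ≤ r + δ - 1 ∧
        ∀ c ∈ C, (∃ j ∈ S, c j ≠ 0) → δ ≤ (S.filter (fun j => c j ≠ 0)).card := by
  simp only [HasInfoLocality, HasSymbolLocality, puncture_minDist_iff]
  constructor
  · rintro ⟨G, hG, I, hI, hrank, hloc⟩
    rw [columnRank_eq_finrank_puncture hG, finrank_puncture_eq_iff] at hrank
    exact ⟨I, hI, hrank, hloc⟩
  · rintro ⟨I, hI, hinf, hloc⟩
    obtain ⟨G, hG⟩ := exists_isGeneratorMatrix C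
    refine ⟨G, hG, I, hI, ?_, hloc⟩
    rwa [columnRank_eq_finrank_puncture hG, finrank_puncture_eq_iff]

/-- An optimal code with coordinates in an arbitrary finite type gives one with coordinates
in `Fin n`. -/
theorem exists_isOptimalLRC_of_fintype {J : Type*} [Fintype J] [DecidableEq J]
    (D : Submodule F (J → F))
    {r δ k d : ℕ} (hcard : Fintype.card J = n) (hdim : Module.finrank F D = k)
    (hlow : ∀ c ∈ D, c ≠ 0 → d ≤ hammingNorm c)
    (hup : ∃ c ∈ D, c ≠ 0 ∧ hammingNorm c ≤ d)
    (I : Finset J) (hI : I.card = k) (hinf : ∀ c ∈ D, (∀ i ∈ I, c i = 0) → c = 0)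
    (hloc : ∀ i ∈ I, ∃ S : Finset J, i ∈ S ∧ S.card ≤ r + δ - 1 ∧
        ∀ c ∈ D, (∃ j ∈ S, c j ≠ 0) → δ ≤ (S.filter (fun j => c j ≠ 0)).card)
    (hbound : (d : ℤ) = (n : ℤ) - k + 1 - (⌈(k : ℚ) / (r : ℚ)⌉ - 1) * ((δ : ℤ) - 1)) :
    ∃ C : Submodule F (Fin n → F), IsOptimalLRC r δ k d C := by
  let e : J ≃ Fin n := Fintype.equivFinOfCardEq hcard
  let E : (J → F) ≃ₗ[F] (Fin n → F) := LinearEquiv.funCongrLeft F F e.symm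
  have hE : ∀ c i, E c i = c (e.symm i) := fun _ _ => rfl
  have hw : ∀ c, hammingNorm (E c) = hammingNorm c := by
    intro c
    refine Finset.card_bij (fun a _ => e.symm a) ?_ ?_ ?_
    · intro a ha
      simpa [hE] using ha
    · intro a _ b _ h
      exact e.symm.injective h
    · intro b hb
      exact ⟨e b, by simpa [hE] using hb, by simp⟩
  have hdimC : Module.finrank F (D.map (E : (J → F) →ₗ[F] (Fin n → F))) = k := by
    rw [← hdim]
    exact LinearEquiv.finrank_map_eq E D
  refine ⟨D.map (E : (J → F) →ₗ[F] (Fin n → F)), hdimC, ⟨?_, ?_⟩, ?_, hbound⟩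
  · obtain ⟨c, hc, hc0, hcd⟩ := hup
    refine ⟨E c, ⟨c, hc, rfl⟩, by simpa using hc0, ?_⟩
    rw [hw]
    exact le_antisymm hcd (hlow c hc hc0)
  · rintro _ ⟨_, ⟨c, hc, rfl⟩, hc0, rfl⟩
    change d ≤ hammingNorm (E c)
    rw [hw]
    exact hlow c hc (by rintro rfl; simp at hc0)
  · rw [hasInfoLocality_iff]
    refine ⟨I.map e.toEmbedding, by rw [Finset.card_map, hI, hdimC], ?_, ?_⟩
    · rintro _ ⟨c, hc, rfl⟩ h
      have : c = 0 := hinf c hc (fun i hi => by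
        have := h (e i) (Finset.mem_map_of_mem _ hi)
        simpa [hE] using this)
      subst this
      simp
    · intro i hi
      obtain ⟨i, hiI, rfl⟩ := Finset.mem_map.1 hi
      obtain ⟨S, hiS, hS, hSd⟩ := hloc i hiI
      refine ⟨S.map e.toEmbedding, Finset.mem_map_of_mem _ hiS, by rwa [Finset.card_map], ?_⟩
      rintro _ ⟨c, hc, rfl⟩ ⟨j, hj, hcj⟩
      obtain ⟨j, hjS, rfl⟩ := Finset.mem_map.1 hj
      have h1 := hSd c hc ⟨j, hjS, by simpa [hE] using hcj⟩
      rw [Finset.filter_map, Finset.card_map]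
      refine h1.trans (le_of_eq ?_)
      congr 1
      ext x
      simp [hE]

end Puncturing

end LRC

namespace LRC

/-! ### Nonsingularity of Cauchy-Vandermonde systems. -/

section CauchyVandermonde

open Polynomial

variable {F : Type*} [Field F] {X κ : Type*} [Fintype X] [DecidableEq κ]

/-- A weight function orthogonal to the monomials of degree `< e` and to the simple fractions with
poles `β j` is orthogonal to all rational functions they span. -/
theorem sum_eval_mul_prod_inv_eq_zero {α : X → F} {β : κ → F} (hβ : Function.Injective β)
    (hαβ : ∀ p j, α p ≠ β j) {f : X → F} {e : ℕ} (hm : ∀ m < e, ∑ p, f p * α p ^ m = 0)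
    (J : Finset κ) :
    (∀ j ∈ J, ∑ p, f p * (α p - β j)⁻¹ = 0) → ∀ P : F[X], P.degree < (J.card + e : ℕ) →
      ∑ p, f p * (P.eval (α p) * ∏ j ∈ J, (α p - β j)⁻¹) = 0 := by
  induction J using Finset.induction_on with
  | empty =>
    intro _ P hP
    rcases eq_or_ne P 0 with rfl | hP0
    · simp
    have hP' : P.natDegree < e := by
      rw [← natDegree_lt_iff_degree_lt hP0] at hP
      simpa using hP
    simp only [Finset.prod_empty, mul_one, eval_eq_sum_range' hP', Finset.mul_sum]
    rw [Finset.sum_comm]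
    refine Finset.sum_eq_zero fun i hi => ?_
    have h1 := hm i (Finset.mem_range.1 hi)
    calc ∑ p, f p * (P.coeff i * α p ^ i) = P.coeff i * ∑ p, f p * α p ^ i := by
          rw [Finset.mul_sum]; exact Finset.sum_congr rfl fun p _ => by ring
      _ = 0 := by rw [h1, mul_zero]
  | insert a J ha ih =>
    intro hc P hP
    let M : F[X] := ∏ j ∈ J, (Polynomial.X - C (β j))
    have hMe : ∀ x, M.eval x = ∏ j ∈ J, (x - β j) := fun x => by simp [M, eval_prod]
    have hMa : M.eval (β a) ≠ 0 := by
      rw [hMe, Finset.prod_ne_zero_iff]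
      intro j hj h0
      exact ha (hβ (sub_eq_zero.1 h0) ▸ hj)
    have hMd : M.degree = (J.card : ℕ) := by simp [M, degree_prod]
    -- Peeling off one partial fraction: with this `c`, `P - c M` vanishes at `β a`, so `P` over the
    -- larger product is `Q` over the smaller one plus `c / (x - β a)`.
    let c : F := P.eval (β a) / M.eval (β a)
    let Q : F[X] := (P - C c * M) /ₘ (Polynomial.X - C (β a))
    have hQ : (Polynomial.X - C (β a)) * Q = P - C c * M := by
      rw [mul_divByMonic_eq_iff_isRoot]
      simp [IsRoot, c, hMa]
    rw [Finset.card_insert_of_notMem ha] at hP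
    have hQd : Q.degree < (J.card + e : ℕ) := by
      rcases eq_or_ne Q 0 with h0 | h0
      · rw [h0, degree_zero]; exact WithBot.bot_lt_coe _
      have h1 : (P - C c * M).degree < (J.card + 1 + e : ℕ) := by
        refine (degree_sub_le _ _).trans_lt (max_lt hP ?_)
        rw [← smul_eq_C_mul]
        refine (degree_smul_le c M).trans_lt ?_
        rw [hMd]
        exact_mod_cast (by omega : J.card < J.card + 1 + e)
      rw [← hQ, degree_mul, degree_X_sub_C, degree_eq_natDegree h0] at h1
      rw [degree_eq_natDegree h0]
      norm_cast at h1 ⊢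
      omega
    have h1 := ih (fun j hj => hc j (Finset.mem_insert_of_mem hj)) Q hQd
    have h2 := hc a (Finset.mem_insert_self _ _)
    calc ∑ p, f p * (P.eval (α p) * ∏ j ∈ insert a J, (α p - β j)⁻¹)
        = ∑ p, (f p * (Q.eval (α p) * ∏ j ∈ J, (α p - β j)⁻¹) +
            c * (f p * (α p - β a)⁻¹)) := by
          refine Finset.sum_congr rfl fun p _ => ?_
          have hPe : P.eval (α p) = (α p - β a) * Q.eval (α p) + c * ∏ j ∈ J, (α p - β j) := by
            have := congrArg (eval (α p)) hQ
            simp only [eval_mul, eval_sub, eval_X, eval_C, hMe] at this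
            rw [this]; ring
          have h3 : α p - β a ≠ 0 := sub_ne_zero.2 (hαβ p a)
          have h4 : ∏ j ∈ J, (α p - β j) ≠ 0 :=
            Finset.prod_ne_zero_iff.2 fun j _ => sub_ne_zero.2 (hαβ p j)
          rw [Finset.prod_insert ha, hPe, Finset.prod_inv_distrib]
          field_simp
      _ = 0 := by rw [Finset.sum_add_distrib, h1, ← Finset.mul_sum, h2]; simp

/-- Testing `f` against a rational function whose numerator vanishes on all of the support except
one point isolates the value of `f` there. The numerator has degree one less than the weight of `f`,
hence is admissible. -/
theorem eq_zero_of_moments [DecidableEq F] {α : X → F} (hα : Function.Injective α) {β : κ → F}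
    (hβ : Function.Injective β)
    (hαβ : ∀ p j, α p ≠ β j) {f : X → F} {e : ℕ} (hm : ∀ m < e, ∑ p, f p * α p ^ m = 0)
    (J : Finset κ) (hc : ∀ j ∈ J, ∑ p, f p * (α p - β j)⁻¹ = 0)
    (hf : hammingNorm f ≤ J.card + e) : f = 0 := by
  classical
  by_contra h0
  obtain ⟨p₀, hp₀⟩ := Function.ne_iff.1 h0
  let s : Finset X := Finset.univ.filter (fun p => f p ≠ 0)
  have hs : p₀ ∈ s := by simpa [s] using hp₀
  let P : F[X] := ∏ p ∈ s.erase p₀, (Polynomial.X - C (α p))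
  have hPe : ∀ x, P.eval x = ∏ p ∈ s.erase p₀, (x - α p) := fun x => by simp [P, eval_prod]
  have hPd : P.degree < (J.card + e : ℕ) := by
    have h1 : P.degree = ((s.erase p₀).card : ℕ) := by simp [P, degree_prod]
    rw [h1]
    have h2 : (s.erase p₀).card < s.card := Finset.card_erase_lt_of_mem hs
    have h3 : s.card ≤ J.card + e := hf
    exact_mod_cast h2.trans_le h3
  have h1 := sum_eval_mul_prod_inv_eq_zero hβ hαβ hm J hc P hPd
  rw [Finset.sum_eq_single p₀] at h1
  · refine absurd h1 (mul_ne_zero hp₀ (mul_ne_zero ?_ ?_))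
    · rw [hPe, Finset.prod_ne_zero_iff]
      intro p hp h
      exact (Finset.mem_erase.1 hp).1 (hα (sub_eq_zero.1 h)).symm
    · exact Finset.prod_ne_zero_iff.2 fun j _ => inv_ne_zero (sub_ne_zero.2 (hαβ p₀ j))
  · intro p _ hp
    by_cases hfp : f p = 0
    · simp [hfp]
    · have : P.eval (α p) = 0 := by
        rw [hPe]
        exact Finset.prod_eq_zero (Finset.mem_erase.2 ⟨hp, by simpa [s] using hfp⟩) (sub_self _)
      simp [this]
  · simp

theorem eq_zero_of_power_moments [DecidableEq F] {α : X → F} (hα : Function.Injective α)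
    {f : X → F} {e : ℕ} (hm : ∀ m < e, ∑ p, f p * α p ^ m = 0) (hf : hammingNorm f ≤ e) :
    f = 0 :=
  eq_zero_of_moments (β := fun i : Fin 0 => i.elim0) hα (fun i => i.elim0) (fun _ i => i.elim0)
    hm ∅ (by simp) (by simpa using hf)

end CauchyVandermonde

/-! ### The code defined by a family of blocks, and its parameters. -/

section Construction

variable {F : Type*} [Field F] {X L : Type*} [Fintype X] [DecidableEq X] [Fintype L] {h : ℕ}

/-- The parity checks: the first `e` power moments of each block, and for each global coordinate
`j` the sum over all blocks weighted by `1 / (α p - β j)`. -/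
def parityChecks (blk : L → Finset X) (e : ℕ) (α : X → F) (β : Fin h → F) :
    ((Σ l, blk l) ⊕ Fin h → F) →ₗ[F] ((L × Fin e) ⊕ Fin h → F) where
  toFun x := Sum.elim
    (fun q => ∑ p : blk q.1, x (Sum.inl ⟨q.1, p⟩) * α p ^ (q.2 : ℕ))
    (fun j => (∑ l, ∑ p : blk l, x (Sum.inl ⟨l, p⟩) * (α p - β j)⁻¹) + x (Sum.inr j))
  map_add' x y := by
    ext q
    rcases q with q | j
    · simp [add_mul, Finset.sum_add_distrib]
    · simp only [Pi.add_apply, Sum.elim_inr, add_mul, Finset.sum_add_distrib]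
      ring
  map_smul' a x := by
    ext q
    rcases q with q | j
    · simp [mul_assoc, Finset.mul_sum]
    · simp [mul_assoc, Finset.mul_sum, mul_add]

/-- The part of a word in block `l`, as a function on the points. -/
def blockWord {blk : L → Finset X} (x : (Σ l, blk l) ⊕ Fin h → F) (l : L) (p : X) : F :=
  if hp : p ∈ blk l then x (Sum.inl ⟨l, ⟨p, hp⟩⟩) else 0

variable {blk : L → Finset X} {e : ℕ} {α : X → F} {β : Fin h → F}

omit [Fintype X] [Fintype L] in
theorem blockWord_coe (x : (Σ l, blk l) ⊕ Fin h → F) (l : L) (p : blk l) :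
    blockWord x l p = x (Sum.inl ⟨l, p⟩) := by
  simp [blockWord]

omit [Fintype L] in
theorem sum_blockWord (x : (Σ l, blk l) ⊕ Fin h → F) (l : L) (g : X → F) :
    ∑ p : blk l, x (Sum.inl ⟨l, p⟩) * g p = ∑ p, blockWord x l p * g p := by
  simp only [← blockWord_coe x]
  rw [Finset.sum_coe_sort (blk l) (fun p => blockWord x l p * g p)]
  refine Finset.sum_subset (Finset.subset_univ _) fun p _ hp => ?_
  simp [blockWord, hp]

theorem mem_ker_parityChecks {x : (Σ l, blk l) ⊕ Fin h → F} :
    x ∈ LinearMap.ker (parityChecks blk e α β) ↔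
      (∀ l, ∀ m < e, ∑ p, blockWord x l p * α p ^ m = 0) ∧
      ∀ j, (∑ p, (∑ l, blockWord x l p) * (α p - β j)⁻¹) + x (Sum.inr j) = 0 := by
  have hg : ∀ j, ∑ p, (∑ l, blockWord x l p) * (α p - β j)⁻¹ =
      ∑ l, ∑ p : blk l, x (Sum.inl ⟨l, p⟩) * (α p - β j)⁻¹ := by
    intro j
    simp only [Finset.sum_mul]
    rw [Finset.sum_comm]
    exact Finset.sum_congr rfl fun l _ => (sum_blockWord x l _).symm
  simp only [hg]
  rw [LinearMap.mem_ker]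
  constructor
  · intro h0
    refine ⟨fun l m hm => ?_, fun j => congrFun h0 (Sum.inr j)⟩
    rw [← sum_blockWord x l (fun p => α p ^ m)]
    exact congrFun h0 (Sum.inl (l, ⟨m, hm⟩))
  · rintro ⟨h1, h2⟩
    ext q
    rcases q with ⟨l, m⟩ | j
    · have := h1 l m m.2
      rw [← sum_blockWord x l (fun p => α p ^ (m : ℕ))] at this
      exact this
    · exact h2 j

variable [DecidableEq F]

theorem hammingNorm_eq_sum_blocks (x : (Σ l, blk l) ⊕ Fin h → F) :
    hammingNorm x = ∑ l, hammingNorm (blockWord x l) +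
      (Finset.univ.filter (fun j => x (Sum.inr j) ≠ 0)).card := by
  simp only [hammingNorm, Finset.card_filter]
  rw [Fintype.sum_sum_type, Fintype.sum_sigma]
  congr 1
  refine Finset.sum_congr rfl fun l _ => ?_
  simp only [← blockWord_coe x]
  rw [Finset.sum_coe_sort (blk l) (fun p => if blockWord x l p ≠ 0 then 1 else 0)]
  refine Finset.sum_subset (Finset.subset_univ _) fun p _ hp => ?_
  simp [blockWord, hp]

omit [Fintype X] [Fintype L] [DecidableEq F] in
theorem eq_zero_of_blockWord {x : (Σ l, blk l) ⊕ Fin h → F} (h1 : ∀ l, blockWord x l = 0)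
    (h2 : ∀ j, x (Sum.inr j) = 0) : x = 0 := by
  ext q
  rcases q with ⟨l, p⟩ | j
  · rw [← blockWord_coe x, h1]; rfl
  · exact h2 j

/-- Words supported in blocks with small pairwise intersections, each of weight at least `δ` and
few in number, cannot cancel. -/
theorem all_eq_zero_of_sum_eq_zero {f : L → X → F} {τ δ : ℕ} (hτ : 1 ≤ τ)
    (hh : h ≤ ⌈(δ : ℚ) / (τ : ℚ)⌉₊ * δ)
    (hsupp : ∀ l, ∀ p ∉ blk l, f l p = 0)
    (hinter : ∀ l l', l ≠ l' → (blk l ∩ blk l').card ≤ τ)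
    (hmin : ∀ l, f l ≠ 0 → δ ≤ hammingNorm (f l))
    (hw : ∑ l, hammingNorm (f l) < h + δ) (hsum : ∑ l, f l = 0) (l : L) : f l = 0 := by
  classical
  by_contra hl
  let N : Finset L := Finset.univ.filter (fun l => f l ≠ 0)
  have hlN : l ∈ N := by simpa [N] using hl
  have h1 : N.card * δ < h + δ := by
    refine lt_of_le_of_lt ?_ hw
    calc N.card * δ = ∑ l ∈ N, δ := by simp
      _ ≤ ∑ l ∈ N, hammingNorm (f l) :=
        Finset.sum_le_sum fun l hl => hmin l (by simpa [N] using hl)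
      _ ≤ ∑ l, hammingNorm (f l) :=
        Finset.sum_le_sum_of_subset (Finset.subset_univ _)
  -- The only use of the upper bound on `h`.
  have h2 : N.card ≤ ⌈(δ : ℚ) / (τ : ℚ)⌉₊ := by
    have : N.card * δ < (⌈(δ : ℚ) / (τ : ℚ)⌉₊ + 1) * δ := by rw [add_mul]; omega
    exact Nat.lt_succ_iff.1 (Nat.lt_of_mul_lt_mul_right this)
  have h3 : (N.card - 1) * τ < δ := by
    have hpos : 0 < N.card := Finset.card_pos.2 ⟨l, hlN⟩
    have h4 : N.card - 1 < ⌈(δ : ℚ) / (τ : ℚ)⌉₊ := by omega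
    rw [Nat.lt_ceil, lt_div_iff₀ (by exact_mod_cast hτ)] at h4
    exact_mod_cast h4
  -- Every nonzero entry of `f l` must be cancelled by another nonzero block through the same point.
  have h5 : hammingNorm (f l) ≤ ((N.erase l).biUnion (fun l' => blk l ∩ blk l')).card := by
    refine Finset.card_le_card fun p hp => ?_
    have hp : f l p ≠ 0 := by simpa using hp
    have hs : ∑ l', f l' p = 0 := by
      rw [← Finset.sum_apply, hsum]; rfl
    obtain ⟨l', hl', hfl'⟩ : ∃ l', l' ≠ l ∧ f l' p ≠ 0 := by
      by_contra! hne
      rw [Finset.sum_eq_single l (fun l' _ h' => hne l' h') (by simp)] at hs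
      exact hp hs
    rw [Finset.mem_biUnion]
    refine ⟨l', Finset.mem_erase.2 ⟨hl', ?_⟩, Finset.mem_inter.2 ⟨?_, ?_⟩⟩
    · simp only [N, Finset.mem_filter, Finset.mem_univ, true_and]
      intro h0
      exact hfl' (by rw [h0]; rfl)
    · by_contra hb
      exact hp (hsupp l p hb)
    · by_contra hb
      exact hfl' (hsupp l' p hb)
  have h6 : ((N.erase l).biUnion (fun l' => blk l ∩ blk l')).card ≤ (N.erase l).card * τ :=
    Finset.card_biUnion_le_card_mul _ _ _ fun l' hl' =>
      hinter l l' (Finset.mem_erase.1 hl').1.symm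
  rw [Finset.card_erase_of_mem hlN] at h6
  have h7 := hmin l hl
  omega

variable {τ δ : ℕ} (hτ : 1 ≤ τ) (hδ : 1 ≤ δ)
  (hα : Function.Injective α) (hβ : Function.Injective β) (hαβ : ∀ p j, α p ≠ β j)
  {rr : L → ℕ}

include hα hδ in
theorem le_hammingNorm_blockWord {x : (Σ l, blk l) ⊕ Fin h → F}
    (hx : x ∈ LinearMap.ker (parityChecks blk (δ - 1) α β)) (l : L) (h0 : blockWord x l ≠ 0) :
    δ ≤ hammingNorm (blockWord x l) := by
  by_contra! hlt
  exact h0 (eq_zero_of_power_moments hα ((mem_ker_parityChecks.1 hx).1 l) (by omega))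

include hτ hδ hα hβ hαβ in
-- Each vanishing global coordinate supplies a Cauchy condition on the sum of the blocks, and each
-- nonvanishing one uses up a unit of weight. The two effects balance, so the sum always has too
-- little weight to be nonzero.
theorem le_hammingNorm_of_mem_ker (hh : h ≤ ⌈(δ : ℚ) / (τ : ℚ)⌉₊ * δ)
    (hinter : ∀ l l', l ≠ l' → (blk l ∩ blk l').card ≤ τ)
    {x : (Σ l, blk l) ⊕ Fin h → F}
    (hx : x ∈ LinearMap.ker (parityChecks blk (δ - 1) α β)) (h0 : x ≠ 0) :
    h + δ ≤ hammingNorm x := by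
  by_contra! hlt
  have hw := hammingNorm_eq_sum_blocks x
  have hker := mem_ker_parityChecks.1 hx
  let J : Finset (Fin h) := Finset.univ.filter (fun j => ¬ x (Sum.inr j) ≠ 0)
  have hJ : (Finset.univ.filter (fun j => x (Sum.inr j) ≠ 0)).card + J.card = h := by
    have := Finset.card_filter_add_card_filter_not (s := (Finset.univ : Finset (Fin h)))
      (fun j => x (Sum.inr j) ≠ 0)
    simpa [J] using this
  have hsum : ∑ l, blockWord x l = 0 := by
    refine eq_zero_of_moments hα hβ hαβ (e := δ - 1) ?_ J ?_ ?_
    · intro m hm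
      simp only [Finset.sum_apply, Finset.sum_mul]
      rw [Finset.sum_comm]
      exact Finset.sum_eq_zero fun l _ => hker.1 l m hm
    · intro j hj
      have h1 := hker.2 j
      have h2 : x (Sum.inr j) = 0 := by simpa [J] using hj
      rw [h2, add_zero] at h1
      simpa only [Finset.sum_apply] using h1
    · have : hammingNorm (∑ l, blockWord x l) ≤ ∑ l, hammingNorm (blockWord x l) := by
        refine le_trans (Finset.card_le_card (t := Finset.univ.biUnion
          (fun l => Finset.univ.filter (fun p => blockWord x l p ≠ 0))) fun p hp => ?_)
          Finset.card_biUnion_le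
        have hp : (∑ l, blockWord x l) p ≠ 0 := by simpa using hp
        rw [Finset.sum_apply] at hp
        obtain ⟨l, -, hl⟩ := Finset.exists_ne_zero_of_sum_ne_zero hp
        simpa using ⟨l, hl⟩
      omega
  have hzero := all_eq_zero_of_sum_eq_zero (f := fun l => blockWord x l) hτ hh
    (fun l p hp => by simp [blockWord, hp]) hinter
    (fun l hl => le_hammingNorm_blockWord hδ hα hx l hl) (by omega) hsum
  refine h0 (eq_zero_of_blockWord hzero fun j => ?_)
  have h1 := hker.2 j
  simpa [hzero] using h1

include hδ in
-- On `δ` points of one block the `δ - 1` moment equations have a nonzero solution; the global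
-- coordinates are then forced and add at most `h` to the weight.
theorem exists_low_weight (l₀ : L) (hl₀ : δ ≤ (blk l₀).card) :
    ∃ x ∈ LinearMap.ker (parityChecks blk (δ - 1) α β), x ≠ 0 ∧ hammingNorm x ≤ h + δ := by
  classical
  obtain ⟨E, hE, hEc⟩ := Finset.exists_subset_card_eq hl₀
  let f : (E → F) →ₗ[F] (Fin (δ - 1) → F) :=
    { toFun := fun y m => ∑ p : E, y p * α p ^ (m : ℕ)
      map_add' := fun y z => by ext m; simp [add_mul, Finset.sum_add_distrib]
      map_smul' := fun a y => by ext m; simp [mul_assoc, Finset.mul_sum] }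
  have hk : LinearMap.ker f ≠ ⊥ := by
    apply LinearMap.ker_ne_bot_of_finrank_lt
    simp [hEc]
    omega
  obtain ⟨y, hy, hy0⟩ := Submodule.exists_mem_ne_zero_of_ne_bot hk
  let w : X → F := fun p => if hp : p ∈ E then y ⟨p, hp⟩ else 0
  have hwE : ∀ p ∉ E, w p = 0 := fun p hp => by simp [w, hp]
  have hwsum : ∀ m < δ - 1, ∑ p, w p * α p ^ m = 0 := by
    intro m hm
    have h1 := congrFun (LinearMap.mem_ker.1 hy) ⟨m, hm⟩
    rw [← Finset.sum_subset (Finset.subset_univ E)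
      (fun p _ hp => by rw [hwE p hp, zero_mul]), ← Finset.sum_coe_sort]
    simpa [f, w] using h1
  let x : (Σ l, blk l) ⊕ Fin h → F := Sum.elim
    (fun q => if q.1 = l₀ then w q.2 else 0) (fun j => - ∑ p, w p * (α p - β j)⁻¹)
  have hx₀ : blockWord x l₀ = w := by
    ext p
    by_cases hp : p ∈ blk l₀
    · simp [blockWord, x, hp]
    · simp [blockWord, hp, hwE p (fun h => hp (hE h))]
  have hxl : ∀ l, l ≠ l₀ → blockWord x l = 0 := by
    intro l hl
    ext p
    by_cases hp : p ∈ blk l <;> simp [blockWord, x, hp, hl]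
  refine ⟨x, mem_ker_parityChecks.2 ⟨fun l m hm => ?_, fun j => ?_⟩, fun h0 => hy0 ?_, ?_⟩
  · by_cases hl : l = l₀
    · subst hl
      rw [hx₀]; exact hwsum m hm
    · simp [hxl l hl]
  · have : ∀ p, ∑ l, blockWord x l p = w p := by
      intro p
      rw [Finset.sum_eq_single l₀ (fun l _ hl => by rw [hxl l hl]; rfl) (by simp), hx₀]
    simp [this, x]
  · ext ⟨p, hp⟩
    have h1 : w p = 0 := by
      rw [← hx₀, h0]
      simp [blockWord]
    simpa [w, hp] using h1
  · rw [hammingNorm_eq_sum_blocks, Finset.sum_eq_single l₀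
      (fun l _ hl => by rw [hxl l hl, hammingNorm_zero]) (by simp), hx₀]
    have h1 : hammingNorm w ≤ E.card := by
      refine Finset.card_le_card fun p hp => ?_
      by_contra h
      simp [hwE p h] at hp
    have h2 : (Finset.univ.filter (fun j => x (Sum.inr j) ≠ 0)).card ≤ h := by
      simpa using Finset.card_le_univ (Finset.univ.filter (fun j => x (Sum.inr j) ≠ 0))
    omega

omit [Fintype X] [DecidableEq X] [DecidableEq F] in
include hδ in
theorem card_coordinates (hcard : ∀ l, (blk l).card = rr l + δ - 1) :
    Fintype.card ((Σ l, blk l) ⊕ Fin h) =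
      ∑ l, rr l + (Fintype.card L * (δ - 1) + h) := by
  have h1 : ∀ l, rr l + δ - 1 = rr l + (δ - 1) := fun l => by omega
  simp only [Fintype.card_sum, Fintype.card_sigma, Fintype.card_coe, hcard, h1, Fintype.card_fin,
    Finset.sum_add_distrib, Finset.sum_const, Finset.card_univ, smul_eq_mul]
  ring

include hα hδ in
-- Any `rr l` points of each block will do: a codeword vanishing there has at most `δ - 1` nonzero
-- entries in the block, and the `δ - 1` moments kill them.
theorem exists_information_set (hcard : ∀ l, (blk l).card = rr l + δ - 1) :
    ∃ I : Finset ((Σ l, blk l) ⊕ Fin h), I.card = ∑ l, rr l ∧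
      (∀ i ∈ I, ∃ q, i = Sum.inl q) ∧
      ∀ x ∈ LinearMap.ker (parityChecks blk (δ - 1) α β), (∀ i ∈ I, x i = 0) → x = 0 := by
  classical
  have hex : ∀ l, ∃ s : Finset (blk l), s.card = rr l := by
    intro l
    obtain ⟨s, -, hs⟩ := Finset.exists_subset_card_eq (s := (Finset.univ : Finset (blk l)))
      (n := rr l) (by simp [hcard]; omega)
    exact ⟨s, hs⟩
  choose s hs using hex
  refine ⟨(Finset.univ.sigma s).disjSum ∅, ?_, ?_, ?_⟩
  · simp [Finset.card_sigma, hs]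
  · intro i hi
    rcases i with q | j
    · exact ⟨q, rfl⟩
    · simp at hi
  · intro x hx hI
    have hker := mem_ker_parityChecks.1 hx
    have hb : ∀ l, blockWord x l = 0 := by
      intro l
      refine eq_zero_of_power_moments hα (hker.1 l) ?_
      have h1 : hammingNorm (blockWord x l) ≤ ((s l)ᶜ.map (Function.Embedding.subtype _)).card := by
        refine Finset.card_le_card fun p hp => ?_
        have hp : blockWord x l p ≠ 0 := by simpa using hp
        have hpb : p ∈ blk l := by
          by_contra hb
          exact hp (by simp [blockWord, hb])
        refine Finset.mem_map.2 ⟨⟨p, hpb⟩, Finset.mem_compl.2 fun hps => hp ?_, rfl⟩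
        have h2 := hI (Sum.inl ⟨l, ⟨p, hpb⟩⟩) (by simpa using hps)
        rw [← h2]
        exact blockWord_coe x l ⟨p, hpb⟩
      rw [Finset.card_map, Finset.card_compl, Fintype.card_coe, hcard, hs] at h1
      omega
    refine eq_zero_of_blockWord hb fun j => ?_
    have h1 := hker.2 j
    simpa [hb] using h1

include hτ hδ hα hβ hαβ in
/-- The code of the parity checks of a family of blocks with small pairwise intersections. -/
theorem exists_isOptimalLRC_of_blocks {r n k : ℕ} (hh : h ≤ ⌈(δ : ℚ) / (τ : ℚ)⌉₊ * δ)
    (hinter : ∀ l l', l ≠ l' → (blk l ∩ blk l').card ≤ τ)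
    (hcard : ∀ l, (blk l).card = rr l + δ - 1) (hrr : ∀ l, rr l ≤ r)
    (l₀ : L) (hl₀ : 1 ≤ rr l₀)
    (hk : k = ∑ l, rr l) (hn : n = k + (Fintype.card L * (δ - 1) + h))
    (hceil : ⌈(k : ℚ) / (r : ℚ)⌉ = Fintype.card L) :
    ∃ C : Submodule F (Fin n → F), IsOptimalLRC r δ k (h + δ) C := by
  classical
  obtain ⟨I, hI, hIl, hinf⟩ := exists_information_set (β := β) hδ hα hcard
  have hJ := card_coordinates (h := h) hδ hcard
  set D := LinearMap.ker (parityChecks blk (δ - 1) α β) with hD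
  have hdim : Module.finrank F D = k := by
    -- The information set bounds the dimension from above, the number of parity checks from below.
    refine le_antisymm ?_ ?_
    · let f : D →ₗ[F] (I → F) :=
        (LinearMap.funLeft F F (fun i : I => (i : (Σ l, blk l) ⊕ Fin h))).domRestrict D
      have hf : Function.Injective f := by
        rw [← LinearMap.ker_eq_bot, LinearMap.ker_eq_bot']
        rintro ⟨x, hx⟩ h0
        exact Subtype.ext (hinf x hx fun i hi => congrFun h0 ⟨i, hi⟩)
      have := LinearMap.finrank_le_finrank_of_injective hf
      rw [Module.finrank_fintype_fun_eq_card, Fintype.card_coe, hI] at this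
      omega
    · have h1 := (parityChecks blk (δ - 1) α β).finrank_range_add_finrank_ker
      have h2 := Submodule.finrank_le (LinearMap.range (parityChecks blk (δ - 1) α β))
      rw [Module.finrank_fintype_fun_eq_card] at h1 h2
      rw [hJ, ← hD] at h1
      simp only [Fintype.card_sum, Fintype.card_prod, Fintype.card_fin] at h2
      omega
  refine exists_isOptimalLRC_of_fintype D (by rw [hJ, hn, hk]) hdim
    (fun x hx h0 => le_hammingNorm_of_mem_ker hτ hδ hα hβ hαβ hh hinter hx h0)
    (exists_low_weight hδ l₀ (by rw [hcard]; omega)) I (by rw [hI, hk]) hinf ?_ ?_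
  · intro i hi
    obtain ⟨⟨l, p⟩, rfl⟩ := hIl i hi
    let ψ : blk l ↪ (Σ l, blk l) ⊕ Fin h :=
      
      ⟨fun p => Sum.inl ⟨l, p⟩, fun p p' hp => by simpa using hp⟩
    refine ⟨Finset.univ.map ψ, Finset.mem_map.2 ⟨p, Finset.mem_univ _, rfl⟩, ?_, ?_⟩
    · rw [Finset.card_map, Finset.card_univ, Fintype.card_coe, hcard]
      have := hrr l
      omega
    · rintro x hx ⟨j, hj, hxj⟩
      obtain ⟨p', -, rfl⟩ := Finset.mem_map.1 hj
      have h1 : blockWord x l ≠ 0 := by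
        intro h0
        apply hxj
        change x (Sum.inl ⟨l, p'⟩) = 0
        rw [← blockWord_coe x, h0]; rfl
      refine (le_hammingNorm_blockWord hδ hα hx l h1).trans ?_
      -- The value `p` on global coordinates is a dummy: the repair set contains none of them.
      refine Finset.card_le_card_of_surjOn
        (fun i => Sum.elim (fun q => (q.2 : X)) (fun _ => (p : X)) i) fun y hy => ?_
      have hy : blockWord x l y ≠ 0 := by simpa using hy
      have hyb : y ∈ blk l := by
        by_contra hb
        exact hy (by simp [blockWord, hb])
      refine ⟨Sum.inl ⟨l, ⟨y, hyb⟩⟩, ?_, rfl⟩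
      rw [Finset.mem_coe, Finset.mem_filter]
      refine ⟨Finset.mem_map.2 ⟨⟨y, hyb⟩, Finset.mem_univ _, rfl⟩, ?_⟩
      rwa [← blockWord_coe x]
  · rw [hceil, hn]
    push_cast [Nat.cast_sub hδ]
    ring

end Construction

end LRC

namespace LRC

/-! ### Upper bound on the length of optimal codes. -/

section LengthBound

variable {F : Type*} [Field F] {ι : Type*}

theorem exists_ne_zero_vanishing [Fintype ι] (D : Submodule F (ι → F)) (A : Finset ι)
    (h : A.card < Module.finrank F D) : ∃ c ∈ D, c ≠ 0 ∧ ∀ i ∈ A, c i = 0 := by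
  let f : D →ₗ[F] (A → F) :=
    (LinearMap.funLeft F F (fun i : A => (i : ι))).domRestrict D
  have hk : LinearMap.ker f ≠ ⊥ := by
    apply LinearMap.ker_ne_bot_of_finrank_lt
    simpa using h
  obtain ⟨⟨c, hc⟩, hx, hne⟩ := Submodule.exists_mem_ne_zero_of_ne_bot hk
  refine ⟨c, hc, fun h0 => hne (Subtype.ext h0), fun i hi => ?_⟩
  exact congrFun (LinearMap.mem_ker.1 hx) ⟨i, hi⟩

/-- The subcode of the words of `C` that vanish on `T`. -/
def vanishingOn (C : Submodule F (ι → F)) (T : Finset ι) : Submodule F (ι → F) where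
  carrier := {c | c ∈ C ∧ ∀ i ∈ T, c i = 0}
  add_mem' := by
    rintro a b ⟨ha, ha'⟩ ⟨hb, hb'⟩
    exact ⟨C.add_mem ha hb, fun i hi => by simp [ha' i hi, hb' i hi]⟩
  zero_mem' := ⟨C.zero_mem, fun _ _ => rfl⟩
  smul_mem' := by
    rintro a c ⟨hc, hc'⟩
    exact ⟨C.smul_mem a hc, fun i hi => by simp [hc' i hi]⟩

variable [DecidableEq ι]

/-- Set the coordinates outside `S` to zero. -/
def maskTo (F : Type*) [Field F] (S : Finset ι) : (ι → F) →ₗ[F] (ι → F) where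
  toFun c i := if i ∈ S then c i else 0
  map_add' a b := by ext i; by_cases h : i ∈ S <;> simp [h]
  map_smul' a b := by ext i; by_cases h : i ∈ S <;> simp [h]

theorem maskTo_apply (S : Finset ι) (c : ι → F) (i : ι) :
    maskTo F S c i = if i ∈ S then c i else 0 := rfl

variable [Fintype ι]

theorem finrank_le_card_of_support (D : Submodule F (ι → F)) (U : Finset ι)
    (hU : ∀ c ∈ D, ∀ i ∉ U, c i = 0) : Module.finrank F D ≤ U.card := by
  by_contra! h
  obtain ⟨c, hc, h0, hv⟩ := exists_ne_zero_vanishing D U h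
  refine h0 (funext fun i => ?_)
  by_cases hi : i ∈ U
  · exact hv i hi
  · exact hU c hc i hi

/-- Rank-nullity for `maskTo F S` on `vanishingOn C T`. It measures the dimension lost when a repair
set is added to `T`. -/
theorem finrank_vanishingOn_union (C : Submodule F (ι → F)) (T S : Finset ι) :
    Module.finrank F ((vanishingOn C T).map (maskTo F S)) +
      Module.finrank F (vanishingOn C (T ∪ S)) = Module.finrank F (vanishingOn C T) := by
  set f := (maskTo F S).domRestrict (vanishingOn C T) with hf
  have h := f.finrank_range_add_finrank_ker
  rw [hf, LinearMap.range_domRestrict, ← hf] at h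
  suffices hv : vanishingOn C (T ∪ S) =
      (LinearMap.ker f).map (vanishingOn C T).subtype by
    rw [hv, Submodule.finrank_map_subtype_eq, h]
  ext c
  simp only [Submodule.mem_map, LinearMap.mem_ker, Submodule.subtype_apply, Subtype.exists,
    exists_and_right, exists_eq_right]
  constructor
  · rintro ⟨hc, hv⟩
    refine ⟨⟨hc, fun i hi => hv i (Finset.mem_union_left _ hi)⟩, ?_⟩
    ext i
    by_cases hi : i ∈ S
    · simpa [hf, maskTo_apply, hi] using hv i (Finset.mem_union_right _ hi)
    · simp [hf, maskTo_apply, hi]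
  · rintro ⟨⟨hc, hv⟩, h0⟩
    refine ⟨hc, fun i hi => ?_⟩
    rcases Finset.mem_union.1 hi with hi | hi
    · exact hv i hi
    · have := congrFun h0 i
      simpa [hf, maskTo_apply, hi] using this

variable [DecidableEq F]

theorem hammingNorm_le_card {c : ι → F} {U : Finset ι} (hU : ∀ i ∉ U, c i = 0) :
    hammingNorm c ≤ U.card := by
  refine Finset.card_le_card fun i hi => ?_
  by_contra h
  simp [hU i h] at hi

/-- The Singleton bound for codes supported on a set of coordinates. -/
theorem singleton_bound (D : Submodule F (ι → F)) (U : Finset ι) (d : ℕ)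
    (hU : ∀ c ∈ D, ∀ i ∉ U, c i = 0) (hd : ∀ c ∈ D, c ≠ 0 → d ≤ hammingNorm c)
    (hD : 0 < Module.finrank F D) : Module.finrank F D + d ≤ U.card + 1 := by
  have h1 := finrank_le_card_of_support D U hU
  obtain ⟨A, hAU, hA⟩ := Finset.exists_subset_card_eq (s := U)
    (n := Module.finrank F D - 1) (by omega)
  obtain ⟨c, hc, h0, hv⟩ := exists_ne_zero_vanishing D A (by omega)
  have h2 := hd c hc h0
  have h3 : hammingNorm c ≤ (U \ A).card := by
    refine hammingNorm_le_card fun i hi => ?_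
    by_cases hiA : i ∈ A
    · exact hv i hiA
    · exact hU c hc i (fun h => hi (Finset.mem_sdiff.2 ⟨h, hiA⟩))
  rw [Finset.card_sdiff_of_subset hAU] at h3
  omega

/-- The code `C` restricted to `S` is zero or has minimum distance at least `δ`. -/
def LocalDist (C : Submodule F (ι → F)) (δ : ℕ) (S : Finset ι) : Prop :=
  ∀ c ∈ C, maskTo F S c ≠ 0 → δ ≤ hammingNorm (maskTo F S c)

theorem finrank_map_maskTo_le {C : Submodule F (ι → F)} {r δ : ℕ} {S : Finset ι}
    (hS : LocalDist C δ S) (hcard : S.card ≤ r + δ - 1) (hδ : 1 ≤ δ) :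
    Module.finrank F (C.map (maskTo F S)) ≤ r := by
  rcases Nat.eq_zero_or_pos (Module.finrank F (C.map (maskTo F S))) with h | h
  · omega
  have := singleton_bound (C.map (maskTo F S)) S δ
    (by rintro _ ⟨c, _, rfl⟩ i hi; simp [maskTo_apply, hi])
    (by rintro _ ⟨c, hc, rfl⟩ h0; exact hS c hc h0) h
  omega

/-- A nonzero word of the subcode is nonzero at some information coordinate; `S` is a repair set of
that coordinate. Masked to `S`, the subcode is nonzero, lives on `S \ T` and keeps distance `δ`, so
the Singleton bound applies to it there. -/
theorem exists_repair_step {C : Submodule F (ι → F)} {r δ : ℕ} (hδ : 1 ≤ δ) {I : Finset ι}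
    (hinf : ∀ c ∈ C, (∀ i ∈ I, c i = 0) → c = 0)
    (hloc : ∀ i ∈ I, ∃ S : Finset ι, i ∈ S ∧ S.card ≤ r + δ - 1 ∧ LocalDist C δ S)
    (T : Finset ι) (hT : 0 < Module.finrank F (vanishingOn C T)) :
    ∃ S : Finset ι, S.card ≤ r + δ - 1 ∧ LocalDist C δ S ∧
      Module.finrank F (vanishingOn C T) ≤ Module.finrank F (vanishingOn C (T ∪ S)) + r ∧
      Module.finrank F (vanishingOn C T) + δ ≤
        Module.finrank F (vanishingOn C (T ∪ S)) + (S \ T).card + 1 := by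
  obtain ⟨c, hc, h0, -⟩ := exists_ne_zero_vanishing (vanishingOn C T) ∅ (by simpa using hT)
  obtain ⟨i, hiI, hci⟩ : ∃ i ∈ I, c i ≠ 0 := by
    by_contra! h
    exact h0 (hinf c hc.1 h)
  obtain ⟨S, hiS, hScard, hS⟩ := hloc i hiI
  have hun := finrank_vanishingOn_union C T S
  have hle : vanishingOn C T ≤ C := fun c hc => hc.1
  have hr := finrank_map_maskTo_le hS hScard hδ
  have hr' := Submodule.finrank_mono (Submodule.map_mono (f := maskTo F S) hle)
  have hpos : 0 < Module.finrank F ((vanishingOn C T).map (maskTo F S)) := by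
    rw [Module.finrank_pos_iff_exists_ne_zero]
    refine ⟨⟨maskTo F S c, c, hc, rfl⟩, fun h => hci ?_⟩
    have := congrFun (congrArg Subtype.val h) i
    simpa [maskTo_apply, hiS] using this
  have hs := singleton_bound ((vanishingOn C T).map (maskTo F S)) (S \ T) δ
    (by
      rintro _ ⟨c, hc, rfl⟩ i hi
      by_cases hiS : i ∈ S
      · have hiT : i ∈ T := by
          by_contra h
          exact hi (Finset.mem_sdiff.2 ⟨hiS, h⟩)
        simp [maskTo_apply, hc.2 i hiT]
      · simp [maskTo_apply, hiS])
    (by rintro _ ⟨c, hc, rfl⟩ h0; exact hS c hc.1 h0) hpos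
  exact ⟨S, hScard, hS, by omega, by omega⟩

/-- In an optimal code with information locality whose dimension is `u * r`, there are `u`
disjoint repair sets of maximal size, whose local codes have dimension `r`. -/
theorem exists_disjoint_repair_sets {C : Submodule F (ι → F)} {r δ h u : ℕ} (hδ : 2 ≤ δ)
    (hr : 1 ≤ r)
    (hk : Module.finrank F C = u * r) (hm : Fintype.card ι = u * (r + δ - 1) + h)
    (hd : ∀ c ∈ C, c ≠ 0 → h + δ ≤ hammingNorm c) {I : Finset ι}
    (hinf : ∀ c ∈ C, (∀ i ∈ I, c i = 0) → c = 0)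
    (hloc : ∀ i ∈ I, ∃ S : Finset ι, i ∈ S ∧ S.card ≤ r + δ - 1 ∧ LocalDist C δ S) :
    ∃ S : Fin u → Finset ι, (∀ j, (S j).card = r + δ - 1) ∧
      (∀ j, Module.finrank F (C.map (maskTo F (S j))) = r) ∧
      Pairwise (fun i j => Disjoint (S i) (S j)) := by
  have hstep := exists_repair_step (by omega) hinf hloc
  -- `g` is total, but its properties hold only while the subcode is nonzero; `hpos` below secures
  -- this for the first `u` steps.
  choose! g hg1 hg2 hg3 hg4 using hstep
  let T : ℕ → Finset ι := fun j => Nat.rec ∅ (fun _ T => T ∪ g T) j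
  have hT0 : T 0 = ∅ := rfl
  have hTs : ∀ j, T (j + 1) = T j ∪ g (T j) := fun _ => rfl
  have hκ0 : Module.finrank F (vanishingOn C (T 0)) = u * r := by
    have h0 : vanishingOn C (T 0) = C := by
      ext c
      exact ⟨fun h => h.1, fun h => ⟨h, by simp [hT0]⟩⟩
    rw [h0, hk]
  have hlow : ∀ j, j ≤ u → u * r ≤ Module.finrank F (vanishingOn C (T j)) + j * r ∧
      u * r + j * (δ - 1) ≤ Module.finrank F (vanishingOn C (T j)) + (T j).card := by
    intro j
    induction j with
    | zero => intro _; rw [hκ0]; simp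
    | succ j ih =>
      intro hj
      obtain ⟨h1, h2⟩ := ih (by omega)
      have hpos : 0 < Module.finrank F (vanishingOn C (T j)) := by
        by_contra h0
        have : (j + 1) * r ≤ u * r := Nat.mul_le_mul_right r hj
        rw [add_mul] at this
        omega
      have h3 := hg3 (T j) hpos
      have h4 := hg4 (T j) hpos
      rw [← hTs] at h3 h4
      have h5 : (T (j + 1)).card = (T j).card + (g (T j) \ T j).card := by
        rw [hTs, ← Finset.union_sdiff_self_eq_union,
          Finset.card_union_of_disjoint Finset.disjoint_sdiff]
      rw [add_mul, add_mul]
      constructor <;> omega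
  -- A nonzero remainder would, by the Singleton bound outside `T u` with distance `h + δ`, force `δ
  -- ≤ 1`.
  have hlast : Module.finrank F (vanishingOn C (T u)) = 0 := by
    by_contra hne
    have h1 := singleton_bound (vanishingOn C (T u)) (T u)ᶜ (h + δ)
      (fun c hc i hi => hc.2 i (by simpa using hi)) (fun c hc => hd c hc.1) (by omega)
    have h2 := (hlow u le_rfl).2
    have h3 : (T u).card ≤ Fintype.card ι := Finset.card_le_univ _
    rw [Finset.card_compl] at h1
    have h4 : u * (r + δ - 1) = u * r + u * (δ - 1) := by
      rw [← mul_add]; congr 1; omega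
    omega
  have hpos : ∀ j, j < u → 0 < Module.finrank F (vanishingOn C (T j)) := by
    intro j hj
    have h1 := (hlow j hj.le).1
    have : (j + 1) * r ≤ u * r := Nat.mul_le_mul_right r hj
    rw [add_mul] at this
    omega
  -- Counting back from the zero subcode, each step costs at most `r`. Together with `hlow`, every
  -- step costs exactly `r`, so each new repair set has full size and avoids the earlier ones.
  have hup : ∀ i, i ≤ u → Module.finrank F (vanishingOn C (T (u - i))) ≤ i * r := by
    intro i
    induction i with
    | zero => intro _; simp [hlast]
    | succ i ih =>
      intro hi
      have h1 := ih (by omega)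
      have h2 := hg3 _ (hpos (u - (i + 1)) (by omega))
      rw [← hTs, show u - (i + 1) + 1 = u - i by omega] at h2
      rw [add_mul]
      omega
  have heq : ∀ j, j ≤ u → Module.finrank F (vanishingOn C (T j)) + j * r = u * r := by
    intro j hj
    have h1 := hup (u - j) (by omega)
    rw [show u - (u - j) = j by omega, Nat.sub_mul] at h1
    have h2 := (hlow j hj).1
    have h3 : j * r ≤ u * r := Nat.mul_le_mul_right r hj
    omega
  have hcard : ∀ j, j < u → r + δ - 1 ≤ (g (T j) \ T j).card := by
    intro j hj
    have h4 := hg4 _ (hpos j hj)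
    rw [← hTs] at h4
    have h5 := heq j hj.le
    have h6 := heq (j + 1) hj
    rw [add_mul] at h6
    omega
  have hTmono : Monotone T := monotone_nat_of_le_succ fun j => by
    rw [hTs]; exact Finset.subset_union_left
  have hdisj : ∀ i j, i < j → j < u → Disjoint (g (T i)) (g (T j)) := by
    intro i j hij hj
    have h1 : g (T i) ⊆ T j := by
      refine Finset.Subset.trans ?_ (hTmono (show i + 1 ≤ j from hij))
      rw [hTs]; exact Finset.subset_union_right
    have h2 : g (T j) \ T j = g (T j) :=
      Finset.eq_of_subset_of_card_le Finset.sdiff_subset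
        ((hg1 _ (hpos j hj)).trans (hcard j hj))
    rw [← h2]
    exact Finset.disjoint_of_subset_left h1 Finset.disjoint_sdiff
  refine ⟨fun j => g (T j), fun j => ?_, fun j => ?_, fun i j hij => ?_⟩
  · exact le_antisymm (hg1 _ (hpos j j.2))
      ((hcard j j.2).trans (Finset.card_le_card Finset.sdiff_subset))
  · refine le_antisymm
      (finrank_map_maskTo_le (hg2 _ (hpos j j.2)) (hg1 _ (hpos j j.2)) (by omega)) ?_
    have h1 := finrank_vanishingOn_union C (T j) (g (T j))
    rw [← hTs] at h1
    have h5 := heq j j.2.le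
    have h6 := heq (j + 1) j.2
    rw [add_mul] at h6
    have hle : vanishingOn C (T j) ≤ C := fun c hc => hc.1
    have h7 := Submodule.finrank_mono (Submodule.map_mono (f := maskTo F (g (T j))) hle)
    beta_reduce
    omega
  · rcases lt_or_gt_of_ne hij with h | h
    · exact hdisj i j h j.2
    · exact (hdisj j i h i.2).symm

/-- The number of repair sets is bounded by counting low-weight words modulo the code. -/
theorem card_repair_sets_le [Fintype F] {C : Submodule F (ι → F)} {r δ h u : ℕ}
    (hr : 1 ≤ r) (hδ : 1 ≤ δ)
    (hh : δ + 1 ≤ h)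
    (hk : Module.finrank F C = u * r) (hm : Fintype.card ι = u * (r + δ - 1) + h)
    (hd : ∀ c ∈ C, c ≠ 0 → h + δ ≤ hammingNorm c)
    (S : Fin u → Finset ι) (hcard : ∀ j, (S j).card = r + δ - 1)
    (hdim : ∀ j, Module.finrank F (C.map (maskTo F (S j))) = r)
    (hdisj : Pairwise (fun i j => Disjoint (S i) (S j))) :
    u * (Fintype.card F - 1) ≤ Fintype.card F ^ (δ + 1) := by
  have hword : ∀ j, ∃ x ∈ C.map (maskTo F (S j)), x ≠ 0 ∧ hammingNorm x ≤ δ := by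
    intro j
    -- Dimension `r` allows `r - 1` prescribed zeros, which leaves `δ` of the `r + δ - 1` positions.
    obtain ⟨A, hA, hAc⟩ := Finset.exists_subset_card_eq (s := S j) (n := r - 1)
      (by rw [hcard]; omega)
    obtain ⟨x, hx, h0, hv⟩ := exists_ne_zero_vanishing (C.map (maskTo F (S j))) A
      (by rw [hdim]; omega)
    refine ⟨x, hx, h0, ?_⟩
    have h1 : hammingNorm x ≤ (S j \ A).card := by
      refine hammingNorm_le_card fun i hi => ?_
      by_cases hiA : i ∈ A
      · exact hv i hiA
      · obtain ⟨c, -, rfl⟩ := hx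
        have : i ∉ S j := fun h => hi (Finset.mem_sdiff.2 ⟨h, hiA⟩)
        simp [maskTo_apply, this]
    rw [Finset.card_sdiff_of_subset hA, hcard, hAc] at h1
    omega
  choose x hxC hx0 hxδ using hword
  have hxS : ∀ j, ∀ i ∉ S j, x j i = 0 := by
    intro j i hi
    obtain ⟨c, -, hc⟩ := hxC j
    rw [← hc]
    simp [maskTo_apply, hi]
  let U : Finset ι := Finset.univ.biUnion S
  let R : Finset ι := Uᶜ
  have hUc : U.card = u * (r + δ - 1) := by
    rw [Finset.card_biUnion (fun i _ j _ hij => hdisj hij)]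
    simp [hcard]
  have hR : R.card = h := by
    rw [Finset.card_compl, hUc, hm]; omega
  have hRS : ∀ i ∈ R, ∀ j, i ∉ S j := by
    intro i hi j hij
    exact (Finset.mem_compl.1 hi) (Finset.mem_biUnion.2 ⟨j, Finset.mem_univ _, hij⟩)
  -- The largest size for which two words of weight `δ` and a word on `A` have total weight at most
  -- `2δ + (h - δ - 1) = h + δ - 1`, below the minimum distance.
  obtain ⟨A, hAR, hA⟩ := Finset.exists_subset_card_eq (s := R) (n := h - δ - 1) (by omega)
  let ext : (A → F) → (ι → F) := fun y i => if hi : i ∈ A then y ⟨i, hi⟩ else 0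
  have hext0 : ∀ y, ∀ i ∉ A, ext y i = 0 := fun y i hi => by simp [ext, hi]
  have hextS : ∀ y j, ∀ i ∈ S j, ext y i = 0 := fun y j i hi =>
    hext0 y i (fun h => hRS i (hAR h) j hi)
  let z : (Fin u × Fˣ) × C × (A → F) → (ι → F) :=
    fun p => (p.1.2 : F) • x p.1.1 + (p.2.1 : ι → F) + ext p.2.2
  have hz : ∀ p j, maskTo F (S j) (z p) ∈ C.map (maskTo F (S j)) := by
    intro p j
    have h1 : maskTo F (S j) (ext p.2.2) = 0 := by
      ext i
      by_cases hi : i ∈ S j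
      · simp [maskTo_apply, hextS _ j i hi]
      · simp [maskTo_apply, hi]
    have h2 : maskTo F (S j) (x p.1.1) ∈ C.map (maskTo F (S j)) := by
      by_cases hj : p.1.1 = j
      · rw [hj]
        have h3 : maskTo F (S j) (x j) = x j := by
          ext i
          by_cases hi : i ∈ S j
          · simp [maskTo_apply, hi]
          · simp [maskTo_apply, hi, hxS j i hi]
        rw [h3]; exact hxC j
      · have h3 : maskTo F (S j) (x p.1.1) = 0 := by
          ext i
          by_cases hi : i ∈ S j
          · have : i ∉ S p.1.1 := Finset.disjoint_right.1 (hdisj hj) hi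
            simp [maskTo_apply, hxS _ i this]
          · simp [maskTo_apply, hi]
        rw [h3]; exact Submodule.zero_mem _
    simp only [z, map_add, map_smul, h1, add_zero]
    exact Submodule.add_mem _ (Submodule.smul_mem _ _ h2) ⟨_, p.2.1.2, rfl⟩
  -- The translates stay among the words that are locally codewords on every `S j` and arbitrary on
  -- `R`; there are `q ^ (u * r + h)` of these.
  let Φ : (Fin u × Fˣ) × C × (A → F) → (∀ j, C.map (maskTo F (S j))) × (R → F) :=
    fun p => (fun j => ⟨maskTo F (S j) (z p), hz p j⟩, fun i => z p i)
  have hΦz : ∀ p p', Φ p = Φ p' → z p = z p' := by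
    intro p p' hpp
    rw [Prod.ext_iff] at hpp
    ext i
    by_cases hi : i ∈ U
    · obtain ⟨j, -, hij⟩ := Finset.mem_biUnion.1 hi
      have := congrFun (congrArg Subtype.val (congrFun hpp.1 j)) i
      simpa [Φ, maskTo_apply, hij] using this
    · exact congrFun hpp.2 ⟨i, Finset.mem_compl.2 hi⟩
  have hinj : Function.Injective Φ := by
    rintro ⟨⟨j, α⟩, ⟨c, hc⟩, y⟩ ⟨⟨j', α'⟩, ⟨c', hc'⟩, y'⟩ hpp
    have hzz := hΦz _ _ hpp
    simp only [z] at hzz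
    have hcc : c = c' := by
      by_contra hne
      have h1 := hd (c - c') (C.sub_mem hc hc') (sub_ne_zero.2 hne)
      have h2 : c - c' = (α' : F) • x j' + (-((α : F) • x j) + (ext y' + -ext y)) := by
        rw [← sub_eq_zero] at hzz ⊢
        rw [← hzz]; abel
      have h3 : hammingNorm (c - c') ≤
          ((Finset.univ.filter (fun i => x j' i ≠ 0)) ∪
            (Finset.univ.filter (fun i => x j i ≠ 0)) ∪ A).card := by
        rw [h2]
        refine hammingNorm_le_card fun i hi => ?_
        simp only [Finset.mem_union, Finset.mem_filter, Finset.mem_univ, true_and, not_or,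
          not_not] at hi
        simp [hi.1.1, hi.1.2, hext0 _ i hi.2]
      have h4 := h3.trans ((Finset.card_union_le _ _).trans
        (Nat.add_le_add_right (Finset.card_union_le _ _) _))
      have h5 : (Finset.univ.filter (fun i => x j' i ≠ 0)).card ≤ δ := hxδ j'
      have h6 : (Finset.univ.filter (fun i => x j i ≠ 0)).card ≤ δ := hxδ j
      omega
    subst hcc
    have hzi : ∀ i, (α : F) * x j i + ext y i = (α' : F) * x j' i + ext y' i := by
      intro i
      have := congrFun hzz i
      simp only [Pi.add_apply, Pi.smul_apply, smul_eq_mul] at this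
      linear_combination this
    have hyy : y = y' := by
      ext ⟨i, hi⟩
      have := hzi i
      rw [hxS j i (hRS i (hAR hi) j), hxS j' i (hRS i (hAR hi) j')] at this
      simpa [ext, hi] using this
    subst hyy
    obtain ⟨i, hi⟩ := Function.ne_iff.1 (hx0 j)
    have hi' : x j i ≠ 0 := hi
    have h7 := add_right_cancel (hzi i)
    -- The words `x j` have disjoint supports, so a common nonzero entry determines `j`.
    have hjj : j = j' := by
      by_contra hne
      have hiS : i ∈ S j := by
        by_contra h
        exact hi' (hxS j i h)
      rw [hxS j' i (Finset.disjoint_left.1 (hdisj hne) hiS), mul_zero] at h7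
      exact (mul_ne_zero α.ne_zero hi') h7
    subst hjj
    have hαα : α = α' := Units.ext (mul_right_cancel₀ hi' h7)
    subst hαα
    rfl
  have hcount := Nat.card_le_card_of_injective Φ hinj
  have hq : 0 < Fintype.card F := Fintype.card_pos
  have hL : Nat.card ((Fin u × Fˣ) × C × (A → F)) =
      u * (Fintype.card F - 1) * Fintype.card F ^ (u * r + (h - δ - 1)) := by
    rw [Nat.card_prod, Nat.card_prod, Nat.card_prod, Module.natCard_eq_pow_finrank (K := F) (V := C),
      hk, Nat.card_fun]
    simp only [Nat.card_eq_fintype_card, Fintype.card_fin, Fintype.card_units, Fintype.card_coe, hA]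
    rw [pow_add]
  have hRr : Nat.card ((∀ j, C.map (maskTo F (S j))) × (R → F)) =
      Fintype.card F ^ (u * r + h) := by
    rw [Nat.card_prod, Nat.card_pi, Nat.card_fun]
    rw [Finset.prod_congr rfl (fun j _ => by
      rw [Module.natCard_eq_pow_finrank (K := F), hdim]), Finset.prod_const]
    simp only [Nat.card_eq_fintype_card, Finset.card_univ, Fintype.card_fin, Fintype.card_coe, hR]
    rw [pow_add, ← pow_mul, mul_comm r u]
  rw [hL, hRr, show u * r + h = (δ + 1) + (u * r + (h - δ - 1)) by omega,
    pow_add _ (δ + 1)] at hcount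
  exact Nat.le_of_mul_le_mul_right hcount (Nat.pow_pos hq)

end LengthBound

/-- Optimal codes with information locality, minimum distance `h + δ` and dimension divisible
by `r` have length `O(q ^ δ)` when `h > δ`. -/
theorem IsOptimalLRC.length_le {F : Type*} [Field F] [Fintype F] [DecidableEq F] {r δ h m k : ℕ}
    (hr : 1 ≤ r) (hδ : 2 ≤ δ) (hh : δ + 1 ≤ h) {C : Submodule F (Fin m → F)}
    (hC : IsOptimalLRC r δ k (h + δ) C) (hrk : r ∣ k) :
    m ≤ (2 * (r + δ - 1) + h) * Fintype.card F ^ δ := by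
  obtain ⟨u, rfl⟩ := hrk
  have hm : m = u * (r + δ - 1) + h := by
    have h1 := hC.bound_eq
    have h2 : ⌈((r * u : ℕ) : ℚ) / (r : ℚ)⌉ = u := by
      have : ((r * u : ℕ) : ℚ) / (r : ℚ) = ((u : ℤ) : ℚ) := by
        have : (r : ℚ) ≠ 0 := by positivity
        push_cast
        field_simp
      rw [this, Int.ceil_intCast]
    rw [h2] at h1
    zify [show 1 ≤ r + δ by omega]
    push_cast at h1
    linear_combination -h1
  obtain ⟨I, -, hinf, hloc⟩ := (hasInfoLocality_iff C r δ).1 hC.locality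
  have hloc' : ∀ i ∈ I, ∃ S : Finset (Fin m), i ∈ S ∧ S.card ≤ r + δ - 1 ∧
      LocalDist C δ S := by
    intro i hi
    obtain ⟨S, hiS, hS, hd⟩ := hloc i hi
    refine ⟨S, hiS, hS, fun c hc h0 => ?_⟩
    obtain ⟨j, hj⟩ := Function.ne_iff.1 h0
    have hj' : j ∈ S ∧ c j ≠ 0 := by
      by_cases hjS : j ∈ S
      · exact ⟨hjS, by simpa [maskTo_apply, hjS] using hj⟩
      · simp [maskTo_apply, hjS] at hj
    refine (hd c hc ⟨j, hj'⟩).trans (Finset.card_le_card fun i hi => ?_)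
    rw [Finset.mem_filter] at hi
    simpa [maskTo_apply, hi.1] using hi.2
  have hk : Module.finrank F C = u * r := by rw [hC.dim_eq, mul_comm]
  have hd : ∀ c ∈ C, c ≠ 0 → h + δ ≤ hammingNorm c := fun c hc h0 =>
    hC.minDist.2 ⟨c, hc, h0, rfl⟩
  have hcm : Fintype.card (Fin m) = u * (r + δ - 1) + h := by rw [Fintype.card_fin, ← hm]
  obtain ⟨S, hS1, hS2, hS3⟩ := exists_disjoint_repair_sets hδ hr hk hcm hd hinf hloc'
  have hu := card_repair_sets_le hr (by omega) hh hk hcm hd S hS1 hS2 hS3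
  have hq : 2 ≤ Fintype.card F := Fintype.one_lt_card
  -- Uses `q / (q - 1) ≤ 2`.
  have hu2 : u ≤ 2 * Fintype.card F ^ δ := by
    obtain ⟨p, hp⟩ : ∃ p, Fintype.card F = p + 2 := ⟨_, (Nat.sub_add_cancel hq).symm⟩
    rw [hp, pow_succ, show p + 2 - 1 = p + 1 by omega] at hu
    rw [hp]
    have : u * (p + 1) ≤ (2 * (p + 2) ^ δ) * (p + 1) := by
      refine hu.trans ?_
      nlinarith [Nat.zero_le ((p + 2) ^ δ), Nat.zero_le ((p + 2) ^ δ * p)]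
    exact Nat.le_of_mul_le_mul_right this (by omega)
  have hq1 : 1 ≤ Fintype.card F ^ δ := Nat.one_le_pow _ _ (by omega)
  rw [hm]
  calc u * (r + δ - 1) + h ≤ 2 * Fintype.card F ^ δ * (r + δ - 1) + h * Fintype.card F ^ δ := by
        gcongr
        exact Nat.le_mul_of_pos_right _ hq1
    _ = _ := by ring

end LRC

namespace LRC

/-! ### From packings and Steiner systems to families of blocks. -/

section Packings

theorem IsPacking.card_inter_le {X : Type*} [Fintype X] [DecidableEq X] {τ N t : ℕ}
    {B : Finset (Finset X)}
    (hB : IsPacking (τ + 1) N t B) {b b' : Finset X} (hb : b ∈ B) (hb' : b' ∈ B) (hne : b ≠ b') :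
    (b ∩ b').card ≤ τ := by
  by_contra! h
  obtain ⟨T, hT, hTc⟩ := Finset.exists_subset_card_eq (show τ + 1 ≤ (b ∩ b').card from h)
  exact hne (hB.at_most_one T hTc b hb b' hb' (hT.trans Finset.inter_subset_left)
    (hT.trans Finset.inter_subset_right))

theorem IsPacking.card_le_choose {X : Type*} [Fintype X] {τ N t : ℕ} {B : Finset (Finset X)}
    (hB : IsPacking τ N t B) (ht : τ ≤ t) : B.card ≤ N.choose τ := by
  have h1 : ∀ b ∈ B, ∃ T ⊆ b, T.card = τ := fun b hb =>
    Finset.exists_subset_card_eq (by rw [hB.card_block b hb]; exact ht)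
  choose! T hT hTc using h1
  rw [← hB.card_points, ← Finset.card_univ, ← Finset.card_powersetCard]
  refine Finset.card_le_card_of_injOn T (fun b hb => ?_) (fun b hb b' hb' h => ?_)
  · exact Finset.mem_coe.2 (Finset.mem_powersetCard.2 ⟨Finset.subset_univ _, hTc b hb⟩)
  · exact hB.at_most_one (T b) (hTc b hb) b hb b' hb' (hT b hb) (h ▸ hT b' hb')

theorem IsSteinerSystem.isPacking {X : Type*} [Fintype X] {τ N t : ℕ} {B : Finset (Finset X)}
    (hB : IsSteinerSystem τ t N B) : IsPacking τ N t B where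
  two_le := hB.two_le
  τ_pos := hB.τ_pos
  t_pos := hB.t_pos
  card_points := hB.card_points
  card_block := hB.card_block
  at_most_one T hT _ hb _ hb' h h' := (hB.exactly_one T hT).unique ⟨hb, h⟩ ⟨hb', h'⟩

/-- The `τ`-subsets of the points are partitioned according to the unique block containing them. -/
theorem IsSteinerSystem.card_mul_choose {X : Type*} [Fintype X] {τ N t : ℕ}
    {B : Finset (Finset X)} (hB : IsSteinerSystem τ t N B) :
    B.card * t.choose τ = N.choose τ := by
  classical
  have h1 : Finset.powersetCard τ (Finset.univ : Finset X) =
      B.biUnion (Finset.powersetCard τ) := by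
    ext T
    simp only [Finset.mem_powersetCard, Finset.subset_univ, true_and, Finset.mem_biUnion]
    constructor
    · intro hT
      obtain ⟨b, ⟨hb, hTb⟩, -⟩ := hB.exactly_one T hT
      exact ⟨b, hb, hTb, hT⟩
    · rintro ⟨b, -, -, hT⟩
      exact hT
  have h2 := congrArg Finset.card h1
  rw [Finset.card_powersetCard, Finset.card_univ, hB.card_points, Finset.card_biUnion] at h2
  · rw [h2, Finset.sum_congr rfl (fun b hb => by
      rw [Finset.card_powersetCard, hB.card_block b hb]), Finset.sum_const, smul_eq_mul]
  · intro b hb b' hb' hne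
    refine Finset.disjoint_left.2 ?_
    intro T hT hT'
    rw [Finset.mem_powersetCard] at hT hT'
    exact hne (hB.isPacking.at_most_one T hT.2 b hb b' hb' hT.1 hT'.1)

theorem IsSteinerSystem.exists_block {X : Type*} [Fintype X] {τ N t : ℕ}
    {B : Finset (Finset X)} (hB : IsSteinerSystem τ t N B) (hN : τ ≤ N) :
    B.Nonempty ∧ τ ≤ t := by
  obtain ⟨T, -, hT⟩ := Finset.exists_subset_card_eq (s := (Finset.univ : Finset X)) (n := τ)
    (by rwa [Finset.card_univ, hB.card_points])
  obtain ⟨b, ⟨hb, hTb⟩, -⟩ := hB.exactly_one T hT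
  exact ⟨⟨b, hb⟩, by rw [← hB.card_block b hb, ← hT]; exact Finset.card_le_card hTb⟩

theorem IsPacking.exists_isOptimalLRC {F : Type*} [Field F] [Fintype F] [DecidableEq F]
    {X : Type*} [Fintype X] {r δ τ h v : ℕ} (hr : 1 ≤ r) (hδ : 1 ≤ δ) (hτ : 1 ≤ τ)
    (hh : h ≤ ⌈(δ : ℚ) / (τ : ℚ)⌉₊ * δ) {B : Finset (Finset X)} (hv : 1 ≤ v ∧ v ≤ r)
    (hB : IsPacking (τ + 1) (Fintype.card F - h) (r + δ - 1) B) (hne : B.Nonempty) {n k : ℕ}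
    (hk : k = (B.card - 1) * r + v) (hn : n = k + (B.card * (δ - 1) + h)) :
    ∃ C : Submodule F (Fin n → F), IsOptimalLRC r δ k (h + δ) C := by
  classical
  -- Excludes truncation in `Fintype.card F - h`, so points and poles together exactly fill the
  -- field.
  have h2 := hB.two_le
  have hcard : Fintype.card (X ⊕ Fin h) = Fintype.card F := by
    rw [Fintype.card_sum, Fintype.card_fin, hB.card_points]; omega
  let E : X ⊕ Fin h ≃ F := Fintype.equivOfCardEq hcard
  obtain ⟨b₀, hb₀⟩ := hne
  -- One block is shortened to `v + δ - 1` points to reach dimensions not divisible by `r`;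
  -- shrinking a block only shrinks intersections.
  let rr : B → ℕ := fun b => if b = ⟨b₀, hb₀⟩ then v else r
  have hrr : ∀ b, rr b ≤ r := fun b => by
    simp only [rr]; split_ifs <;> omega
  have hex : ∀ b : B, ∃ s ⊆ b.1, s.card = rr b + δ - 1 := fun b =>
    Finset.exists_subset_card_eq (by
      rw [hB.card_block b b.2]
      have := hrr b
      omega)
  choose blk hblk hblkc using hex
  have hpos : 1 ≤ B.card := Finset.card_pos.2 ⟨b₀, hb₀⟩
  have hsum : ∑ b, rr b = (B.card - 1) * r + v := by
    rw [← Finset.add_sum_erase _ _ (Finset.mem_univ (⟨b₀, hb₀⟩ : B)),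
      Finset.sum_congr rfl (fun b hb => if_neg (Finset.mem_erase.1 hb).1), Finset.sum_const,
      Finset.card_erase_of_mem (Finset.mem_univ _), Finset.card_univ, Fintype.card_coe]
    simp [rr, add_comm]
  refine exists_isOptimalLRC_of_blocks (blk := blk) (α := fun p => E (Sum.inl p))
    (β := fun j => E (Sum.inr j)) (rr := rr) hτ hδ
    (fun p p' hp => Sum.inl_injective (E.injective hp))
    (fun p p' hp => Sum.inr_injective (E.injective hp))
    (fun p j hp => Sum.inl_ne_inr (E.injective hp)) hh ?_ hblkc hrr ⟨b₀, hb₀⟩ ?_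
    (by rw [hk, hsum]) (by rw [hn, Fintype.card_coe]) ?_
  · intro b b' hbb
    exact (Finset.card_le_card (Finset.inter_subset_inter (hblk b) (hblk b'))).trans
      (hB.card_inter_le b.2 b'.2 (fun h => hbb (Subtype.ext h)))
  · simp [rr, hv.1]
  · rw [Fintype.card_coe, Int.ceil_eq_iff, hk]
    have hr' : (0 : ℚ) < r := by exact_mod_cast hr
    have hv1 : (1 : ℚ) ≤ v := by exact_mod_cast hv.1
    have hv2 : (v : ℚ) ≤ r := by exact_mod_cast hv.2
    push_cast [Nat.cast_sub hpos]
    rw [lt_div_iff₀ hr', div_le_iff₀ hr']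
    constructor <;> linarith

end Packings

/-! ### Growth of the lengths and order-optimality. -/

section Asymptotics

variable {ι : Type*} {l : Filter ι}

theorem isOrderOptimalLength_of_isTheta {δ h : ℕ} {q n : ι → ℕ} (hδ : 1 ≤ δ) (hh : δ + 1 ≤ h)
    (hn : (fun i => (n i : ℝ)) =Θ[l] (fun i => (q i : ℝ) ^ δ)) :
    IsOrderOptimalLength l δ h q n := by
  -- The choice `a = h - δ - 1` puts the bound in its even case, with exponent `2 (δ + 1) / 2 - 1 =
  -- δ`.
  have hT : levelT δ h (h - δ - 1) = 2 := by
    rw [levelT, show h + δ - (h - δ - 1) - 1 = 2 * δ by omega, Nat.mul_div_cancel _ (by omega)]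
  have hb : boundExponent δ h (h - δ - 1) = (δ : ℕ) := by
    rw [boundExponent, hT, if_neg (by decide), Nat.sub_sub, Nat.cast_sub hh]
    push_cast
    ring
  refine ⟨h - δ - 1, by omega, hT.ge, ?_⟩
  simpa only [hb, Real.rpow_natCast] using hn

theorem isLongestUpToConstant_of_isBigO {r δ h : ℕ} (hr : 1 ≤ r) (hδ : 2 ≤ δ) (hh : δ + 1 ≤ h)
    (F : ι → Type*) [∀ i, Field (F i)] [∀ i, Fintype (F i)] [∀ i, DecidableEq (F i)] {n : ι → ℕ}
    (hn : (fun i => (Fintype.card (F i) : ℝ) ^ δ) =O[l] (fun i => (n i : ℝ))) :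
    IsLongestUpToConstant l r δ h F n := by
  obtain ⟨c, hc⟩ := hn.bound
  refine ⟨((2 * (r + δ - 1) + h : ℕ) : ℝ) * c, ?_⟩
  filter_upwards [hc] with i hi m k C hC hrk
  rw [Real.norm_of_nonneg (by positivity), Real.norm_of_nonneg (by positivity)] at hi
  have h1 : (m : ℝ) ≤ ((2 * (r + δ - 1) + h : ℕ) : ℝ) * (Fintype.card (F i) : ℝ) ^ δ := by
    exact_mod_cast hC.length_le hr hδ hh hrk
  rw [mul_assoc]
  exact h1.trans (mul_le_mul_of_nonneg_left hi (by positivity))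

theorem isBigO_card_pow {h t : ℕ} {q : ι → ℕ} (hq : ∀ i, 1 ≤ q i - h) :
    (fun i => (q i : ℝ) ^ t) =O[l] (fun i => ((q i - h : ℕ) : ℝ) ^ t) := by
  refine IsBigO.of_bound ((1 + h : ℝ) ^ t) (Eventually.of_forall fun i => ?_)
  rw [Real.norm_of_nonneg (by positivity), Real.norm_of_nonneg (by positivity), ← mul_pow]
  refine pow_le_pow_left₀ (by positivity) ?_ _
  -- Valid because `q i - h ≥ 1`, which gives `h ≤ h (q i - h)`.
  have h1 : q i ≤ (1 + h) * (q i - h) := by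
    have h2 := Nat.le_mul_of_pos_right h (hq i)
    have h3 := hq i
    rw [add_mul]
    omega
  exact_mod_cast h1

theorem pow_le_mul_choose {N t : ℕ} (ht : 1 ≤ t) (hN : t ≤ N) :
    N ^ t ≤ t ^ t * t.factorial * N.choose t := by
  -- With `N = t + a` this reads `t + a ≤ t a + t`.
  have h1 : N ≤ t * (N + 1 - t) := by
    obtain ⟨a, rfl⟩ := Nat.exists_eq_add_of_le hN
    rw [show t + a + 1 - t = a + 1 by omega, mul_add]
    have := Nat.le_mul_of_pos_left a ht
    omega
  calc N ^ t ≤ (t * (N + 1 - t)) ^ t := Nat.pow_le_pow_left h1 t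
    _ = t ^ t * (N + 1 - t) ^ t := mul_pow _ _ _
    _ ≤ t ^ t * N.descFactorial t := Nat.mul_le_mul_left _ (Nat.pow_sub_le_descFactorial N t)
    _ = _ := by rw [Nat.descFactorial_eq_factorial_mul_choose, mul_assoc]

variable (F : ι → Type*) [∀ i, Field (F i)] [∀ i, Fintype (F i)] [∀ i, DecidableEq (F i)]
  {X : ι → Type*} [∀ i, Fintype (X i)]

theorem exists_optimal_codes_of_packings {r δ τ h : ℕ} (hr : 1 ≤ r) (hδ : 1 ≤ δ) (hτ : 1 ≤ τ)
    (hh : h ≤ ⌈(δ : ℚ) / (τ : ℚ)⌉₊ * δ) {B : ∀ i, Finset (Finset (X i))}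
    {v : ι → ℕ} (hv : ∀ i, 1 ≤ v i ∧ v i ≤ r)
    (hB : ∀ i, IsPacking (τ + 1) (Fintype.card (F i) - h) (r + δ - 1) (B i))
    (hne : ∀ i, (B i).Nonempty)
    (hO : (fun i => (((Fintype.card (F i) - h : ℕ) : ℝ)) ^ (τ + 1)) =O[l]
        (fun i => ((B i).card : ℝ))) :
    ∃ (n k : ι → ℕ) (C : ∀ i, Submodule (F i) (Fin (n i) → F i)),
      (∀ i, (n i : ℤ) = ((B i).card : ℤ) * ((r : ℤ) + δ - 1) + h + v i - r) ∧
      (∀ i, (k i : ℤ) = (((B i).card : ℤ) - 1) * r + v i) ∧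
      (∀ i, IsOptimalLRC r δ (k i) (h + δ) (C i)) ∧
      (fun i => (Fintype.card (F i) : ℝ) ^ (τ + 1)) =O[l] (fun i => (n i : ℝ)) ∧
      (δ + 1 ≤ h → (∀ i, v i = r) → τ + 1 = δ →
        (fun i => (n i : ℝ)) =Θ[l] (fun i => (Fintype.card (F i) : ℝ) ^ δ) ∧
        IsOrderOptimalLength l δ h (fun i => Fintype.card (F i)) n ∧
        IsLongestUpToConstant l r δ h F n) := by
  have hpos : ∀ i, 1 ≤ (B i).card := fun i => Finset.card_pos.2 (hne i)
  let k : ι → ℕ := fun i => ((B i).card - 1) * r + v i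
  let n : ι → ℕ := fun i => k i + ((B i).card * (δ - 1) + h)
  have hC : ∀ i, ∃ C : Submodule (F i) (Fin (n i) → F i), IsOptimalLRC r δ (k i) (h + δ) C :=
    fun i => (hB i).exists_isOptimalLRC hr hδ hτ hh (hv i) (hne i) rfl rfl
  choose C hC using hC
  have hk : ∀ i, (k i : ℤ) = (((B i).card : ℤ) - 1) * r + v i := by
    intro i
    simp only [k]
    push_cast [Nat.cast_sub (hpos i)]
    ring
  have hn : ∀ i, (n i : ℤ) = ((B i).card : ℤ) * ((r : ℤ) + δ - 1) + h + v i - r := by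
    intro i
    simp only [n]
    push_cast [Nat.cast_sub hδ]
    rw [hk]
    ring
  have hBn : ∀ i, (B i).card ≤ n i := by
    intro i
    have h1 := Nat.le_mul_of_pos_right ((B i).card - 1) hr
    have h2 := (hv i).1
    have h3 := hpos i
    simp only [n, k]
    omega
  have hlow : (fun i => (Fintype.card (F i) : ℝ) ^ (τ + 1)) =O[l] (fun i => (n i : ℝ)) := by
    refine (isBigO_card_pow fun i => (by have := (hB i).two_le; omega)).trans (hO.trans ?_)
    refine IsBigO.of_bound 1 (Eventually.of_forall fun i => ?_)
    rw [Real.norm_of_nonneg (by positivity), Real.norm_of_nonneg (by positivity), one_mul]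
    exact_mod_cast hBn i
  refine ⟨n, k, C, hn, hk, hC, hlow, fun hδh hvr hτδ => ?_⟩
  rw [hτδ] at hlow
  have hΘ : (fun i => (n i : ℝ)) =Θ[l] (fun i => (Fintype.card (F i) : ℝ) ^ δ) := by
    refine ⟨IsBigO.of_bound ((r + δ - 1 + h : ℕ) : ℝ) (Eventually.of_forall fun i => ?_), hlow⟩
    rw [Real.norm_of_nonneg (by positivity), Real.norm_of_nonneg (by positivity)]
    -- Distinct blocks contain distinct `δ`-subsets, since here `τ + 1 = δ`.
    have h1 : (B i).card ≤ Fintype.card (F i) ^ δ := by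
      refine ((hB i).card_le_choose (by omega)).trans ((Nat.choose_le_pow _ _).trans ?_)
      rw [hτδ]
      exact Nat.pow_le_pow_left (Nat.sub_le _ _) _
    have h2 : n i = (B i).card * (r + δ - 1) + h := by
      zify [show 1 ≤ r + δ by omega]
      rw [hn, hvr]
      ring
    have h3 : 1 ≤ Fintype.card (F i) ^ δ := Nat.one_le_pow _ _ Fintype.card_pos
    have h4 : n i ≤ (r + δ - 1 + h) * Fintype.card (F i) ^ δ := by
      rw [h2, add_mul, mul_comm (r + δ - 1)]
      exact Nat.add_le_add (Nat.mul_le_mul_right _ h1) (Nat.le_mul_of_pos_right _ h3)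
    exact_mod_cast h4
  exact ⟨hΘ, isOrderOptimalLength_of_isTheta hδ hδh hΘ,
    isLongestUpToConstant_of_isBigO hr (by omega) hδh F hlow⟩

theorem exists_optimal_codes_of_steinerSystems {r δ τ h : ℕ} (hr : 1 ≤ r) (hδ : 1 ≤ δ)
    (hτ : 1 ≤ τ) (hh : h ≤ ⌈(δ : ℚ) / (τ : ℚ)⌉₊ * δ) {B : ∀ i, Finset (Finset (X i))}
    (hB : ∀ i, IsSteinerSystem (τ + 1) (r + δ - 1) (Fintype.card (F i) - h) (B i))
    (hq : ∀ i, τ + 1 ≤ Fintype.card (F i) - h) :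
    ∃ (n k : ι → ℕ) (C : ∀ i, Submodule (F i) (Fin (n i) → F i)),
      (∀ i, (n i : ℚ) =
        ((Fintype.card (F i) - h).choose (τ + 1) : ℚ) * ((r : ℚ) + δ - 1) /
          ((r + δ - 1).choose (τ + 1) : ℚ) + h) ∧
      (∀ i, (k i : ℚ) =
        (r : ℚ) * ((Fintype.card (F i) - h).choose (τ + 1) : ℚ) /
          ((r + δ - 1).choose (τ + 1) : ℚ)) ∧
      (∀ i, IsOptimalLRC r δ (k i) (h + δ) (C i)) ∧
      (fun i => (Fintype.card (F i) : ℝ) ^ (τ + 1)) =O[l] (fun i => (n i : ℝ)) ∧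
      (δ + 1 ≤ h → τ + 1 = δ →
        (fun i => (n i : ℝ)) =Θ[l] (fun i => (Fintype.card (F i) : ℝ) ^ δ) ∧
        IsOrderOptimalLength l δ h (fun i => Fintype.card (F i)) n ∧
        IsLongestUpToConstant l r δ h F n) := by
  have hO : (fun i => (((Fintype.card (F i) - h : ℕ) : ℝ)) ^ (τ + 1)) =O[l]
      (fun i => ((B i).card : ℝ)) := by
    refine IsBigO.of_bound
      (((τ + 1) ^ (τ + 1) * (τ + 1).factorial * (r + δ - 1).choose (τ + 1) : ℕ) : ℝ)
      (Eventually.of_forall fun i => ?_)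
    rw [Real.norm_of_nonneg (by positivity), Real.norm_of_nonneg (by positivity)]
    have h1 := pow_le_mul_choose (by omega) (hq i)
    rw [← (hB i).card_mul_choose, mul_comm (B i).card, ← mul_assoc] at h1
    exact_mod_cast h1
  obtain ⟨n, k, C, hn, hk, hC, hlow, hopt⟩ := exists_optimal_codes_of_packings F hr hδ hτ hh
    (v := fun _ => r) (fun _ => ⟨hr, le_rfl⟩) (fun i => (hB i).isPacking)
    (fun i => ((hB i).exists_block (hq i)).1) hO
  -- The denominator is nonzero because some block contains a `(τ + 1)`-subset, so `τ + 1 ≤ r + δ -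
  -- 1`.
  have hdiv : ∀ i, ((B i).card : ℚ) = ((Fintype.card (F i) - h).choose (τ + 1) : ℚ) /
      ((r + δ - 1).choose (τ + 1) : ℚ) := by
    intro i
    have h1 : ((r + δ - 1).choose (τ + 1) : ℚ) ≠ 0 := by
      exact_mod_cast (Nat.choose_pos ((hB i).exists_block (hq i)).2).ne'
    rw [eq_div_iff h1]
    exact_mod_cast (hB i).card_mul_choose
  refine ⟨n, k, C, fun i => ?_, fun i => ?_, hC, hlow, fun h1 h2 => hopt h1 (fun _ => rfl) h2⟩
  · have h1 : (n i : ℚ) = ((B i).card : ℚ) * ((r : ℚ) + δ - 1) + h + r - r := by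
      exact_mod_cast hn i
    rw [h1, hdiv]
    ring
  · have h1 : (k i : ℚ) = (((B i).card : ℚ) - 1) * r + r := by exact_mod_cast hk i
    rw [h1, hdiv]
    ring

end Asymptotics

end LRC

theorem mainTheorem5 {ι : Type*} (l : Filter ι)
    (F : ι → Type*) [∀ i, Field (F i)] [∀ i, Fintype (F i)] [∀ i, DecidableEq (F i)]
    (X : ι → Type*) [∀ i, Fintype (X i)]
    (r δ τ h : ℕ) (hr : 1 ≤ r) (hδ : 1 ≤ δ) (hτ : 1 ≤ τ)
    (hh : h ≤ ⌈(δ : ℚ) / (τ : ℚ)⌉₊ * δ)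
    (B : ∀ i, Finset (Finset (X i))) :
    -- codes from packings
    (∀ v : ι → ℕ, (∀ i, 1 ≤ v i ∧ v i ≤ r) →
      (∀ i, LRC.IsPacking (τ + 1) (Fintype.card (F i) - h) (r + δ - 1) (B i)) →
      (∀ i, (B i).Nonempty) →
      (fun i => (((Fintype.card (F i) - h : ℕ) : ℝ)) ^ (τ + 1)) =O[l]
        (fun i => ((B i).card : ℝ)) →
      ∃ (n k : ι → ℕ) (C : ∀ i, Submodule (F i) (Fin (n i) → F i)),
        (∀ i, (n i : ℤ) = ((B i).card : ℤ) * ((r : ℤ) + δ - 1) + h + v i - r) ∧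
        (∀ i, (k i : ℤ) = (((B i).card : ℤ) - 1) * r + v i) ∧
        (∀ i, LRC.IsOptimalLRC r δ (k i) (h + δ) (C i)) ∧
        (fun i => (Fintype.card (F i) : ℝ) ^ (τ + 1)) =O[l] (fun i => (n i : ℝ)) ∧
        (δ + 1 ≤ h → (∀ i, v i = r) → τ + 1 = δ →
          (fun i => (n i : ℝ)) =Θ[l] (fun i => (Fintype.card (F i) : ℝ) ^ δ) ∧
          LRC.IsOrderOptimalLength l δ h (fun i => Fintype.card (F i)) n ∧
          LRC.IsLongestUpToConstant l r δ h F n)) ∧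
    -- codes from Steiner systems
    ((∀ i, LRC.IsSteinerSystem (τ + 1) (r + δ - 1) (Fintype.card (F i) - h) (B i)) →
      (∀ i, τ + 1 ≤ Fintype.card (F i) - h) →
      ∃ (n k : ι → ℕ) (C : ∀ i, Submodule (F i) (Fin (n i) → F i)),
        (∀ i, (n i : ℚ) =
          ((Fintype.card (F i) - h).choose (τ + 1) : ℚ) * ((r : ℚ) + δ - 1) /
            ((r + δ - 1).choose (τ + 1) : ℚ) + h) ∧
        (∀ i, (k i : ℚ) =
          (r : ℚ) * ((Fintype.card (F i) - h).choose (τ + 1) : ℚ) /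
            ((r + δ - 1).choose (τ + 1) : ℚ)) ∧
        (∀ i, LRC.IsOptimalLRC r δ (k i) (h + δ) (C i)) ∧
        (fun i => (Fintype.card (F i) : ℝ) ^ (τ + 1)) =O[l] (fun i => (n i : ℝ)) ∧
        (δ + 1 ≤ h → τ + 1 = δ →
          (fun i => (n i : ℝ)) =Θ[l] (fun i => (Fintype.card (F i) : ℝ) ^ δ) ∧
          LRC.IsOrderOptimalLength l δ h (fun i => Fintype.card (F i)) n ∧
          LRC.IsLongestUpToConstant l r δ h F n)) := by
  exact ⟨fun v hv hB hne hO =>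
      LRC.exists_optimal_codes_of_packings F hr hδ hτ hh hv hB hne hO,
    fun hB hq => LRC.exists_optimal_codes_of_steinerSystems F hr hδ hτ hh hB hq⟩
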